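/- Let $R$ be a commutative ring with unit. A dga is a graded $R$-module $A=\bigoplus_{i\in\mathbb Z}A^i$ with an associative unital multiplication of degree $0$ and a differential $d$ of degree $+1$ with $d^2=0$ and $d(ab)=da\cdot b+(-1)^{|a|}a\cdot db$. It is 1-reduced if $A^i=0$ for $i<0$, $A^0=R$ (via the unit) and $A^1=0$. For a 1-reduced dga $A$ let $\bar A=s^{-1}(A_{>0})$, so $|\bar a|=|a|-1$, and let $BA=T(\bar A)$ be the bar construction, with the deconcatenation coproduct $\Delta$ and, with $\varepsilon_i=\sum_{j<i}|\bar a_j|$, the differential $$d[\bar a_1|\dots|\bar a_n]=-\sum_{i=1}^n(-1)^{\varepsilon_i}[\bar a_1|\dots|\overline{da_i}|\dots|\bar a_n]-\sum_{i=2}^n(-1)^{\varepsilon_i}[\bar a_1|\dots|\overline{a_{i-1}a_i}|\dots|\bar a_n].$$ Let $\phi:BA\to A$, $[\bar a]\mapsto a$, be the universal twisting cochain (zero on words of length $\ne1$). The acyclic bar construction $B(A;A)$ is $A\otimes BA$ with $|a\otimes x|=|a|+|x|$ and the twisted differential $d_\phi(a\otimes x)=da\otimes x+(-1)^{|a|}a\otimes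 dx-(-1)^{|a|}\sum a\,\phi(x')\otimes x''$, where $\Delta x=\sum x'\otimes x''$. A homotopy G-algebra is a 1-reduced dga $A$ with multilinear operations $E_{p,q}:A^{\otimes p}\otimes A^{\otimes q}\to A$ of degree $1-p-q$ ($p+q>0$), all zero except $E_{1,0}=E_{0,1}=\mathrm{id}$ and $E_{k,1}$, $k\ge1$, normalized by $E_{k,1}(a_1,\dots,a_k;1)=0$ for $k\ge 1$ and $a_1,\dots,a_k\in A_{>0}$, such that (1) the map $E:BA\otimes BA\to A$ of degree $1$, $E([\bar a_1|\dots|\bar a_p]\otimes[\bar b_1|\dots|\bar b_q])=E_{p,q}(a_1,\dots,a_p;b_1,\dots,b_q)$ (with $E(1\otimes 1)=0$), is a twisting cochain: $dE+Ed=-E\smile E$, where $E\smile E=\mu_A(E\otimes E)\Delta_{BA\otimes BA}$ with Koszul signs; (2) the comultiplicative extension $\mu_E:BA\otimes BA\to BA$ of $E$, written $x\circ y$, is associative. Then, for every homotopy G-algebra $A$, the acyclic bar construction $B(A;A)$ with differential $d_\phi$, unit $1\otimes[\,]$ and the twisted multiplication determined by $$(a_0\otimes[\bar a_1|\dots|\bar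 a_n])(b_0\otimes[\bar b_1|\dots|\bar b_m])=\sum_{k=0}^n(-1)^{|b_0|(|\bar a_{k+1}|+\dots+|\bar a_n|)+|\bar a_1|+\dots+|\bar a_k|}\,a_0E_{k,1}(a_1,\dots,a_k;b_0)\otimes[\bar a_{k+1}|\dots|\bar a_n]\circ[\bar b_1|\dots|\bar b_m]$$ (homogeneous $a_i$, $b_j$, with $E_{0,1}=\mathrm{id}$) is a dga. -/

import Mathlib

open scoped TensorProduct DirectSum

/-! ## Graded modules and Koszul signs -/

/-- A `ℤ`-graded `R`-module: a module `M` that is the direct sum of submodules `deg i`. -/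
structure GrMod (R : Type*) (M : Type*) [CommRing R] [AddCommGroup M] [Module R M] where
  deg : ℤ → Submodule R M
  internal : DirectSum.IsInternal deg

namespace GrMod

variable {R M N P : Type*} [CommRing R] [AddCommGroup M] [Module R M] [AddCommGroup N] [Module R N]
  [AddCommMonoid P] [Module R P]

/-- The linear map that is `f i` on the component of degree `i`. -/
noncomputable def byDegree (G : GrMod R M) (f : ∀ i : ℤ, G.deg i →ₗ[R] P) : M →ₗ[R] P :=
  DirectSum.toModule R ℤ P f ∘ₗ
    (LinearEquiv.ofBijective (DirectSum.coeLinearMap G.deg) G.internal).symm.toLinearMap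

theorem byDegree_apply (G : GrMod R M) (f : ∀ i : ℤ, G.deg i →ₗ[R] P) {i : ℤ} {a : M}
    (ha : a ∈ G.deg i) : G.byDegree f a = f i ⟨a, ha⟩ := by
  have h : (LinearEquiv.ofBijective (DirectSum.coeLinearMap G.deg) G.internal).symm a =
      DirectSum.lof R ℤ (fun i => G.deg i) i ⟨a, ha⟩ := by
    rw [LinearEquiv.symm_apply_eq]
    exact (DirectSum.coeLinearMap_lof G.deg i ⟨a, ha⟩).symm
  simp [byDegree, h]

theorem ext_deg (G : GrMod R M) {f g : M →ₗ[R] P} (h : ∀ i, ∀ a ∈ G.deg i, f a = g a) : f = g := by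
  ext a
  have ha : a ∈ ⨆ i, G.deg i := by rw [G.internal.submodule_iSup_eq_top]; trivial
  induction ha using Submodule.iSup_induction' with
  | mem i x hx => exact h i x hx
  | zero => simp
  | add x y _ _ hx hy => simp [hx, hy]

/-- The sign operator `a ↦ (-1) ^ |a| a`. -/
noncomputable def sgn (G : GrMod R M) : M →ₗ[R] M :=
  G.byDegree fun i => i.negOnePow • (G.deg i).subtype

theorem sgn_apply (G : GrMod R M) {i : ℤ} {a : M} (ha : a ∈ G.deg i) :
    G.sgn a = i.negOnePow • a := by
  simp [sgn, G.byDegree_apply _ ha]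

/-- The interchange map `x ⊗ y ↦ (-1) ^ (|x| |y|) y ⊗ x`. -/
noncomputable def swap (G : GrMod R M) (H : GrMod R N) : M ⊗[R] N →ₗ[R] N ⊗[R] M :=
  TensorProduct.lift (G.byDegree fun i =>
    LinearMap.lcomp R (N ⊗[R] M) (H.byDegree fun j => (i * j).negOnePow • (H.deg j).subtype) ∘ₗ
      (TensorProduct.mk R N M).flip ∘ₗ (G.deg i).subtype)

theorem swap_tmul (G : GrMod R M) (H : GrMod R N) {i j : ℤ} {x : M} {y : N}
    (hx : x ∈ G.deg i) (hy : y ∈ H.deg j) :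
    G.swap H (x ⊗ₜ y) = (i * j).negOnePow • (y ⊗ₜ x) := by
  simp [swap, G.byDegree_apply _ hx, H.byDegree_apply _ hy]

/-- The submodule of elements of total degree `n` in a tensor product. -/
def tensorDeg (G : GrMod R M) (H : GrMod R N) (n : ℤ) : Submodule R (M ⊗[R] N) :=
  ⨆ i : ℤ, LinearMap.range (TensorProduct.map (G.deg i).subtype (H.deg (n - i)).subtype)

/-- The submodule `M_{>0}`. -/
def pos (G : GrMod R M) : Submodule R M := ⨆ i : {i : ℤ // 0 < i}, G.deg i

theorem deg_le_pos (G : GrMod R M) {i : ℤ} (hi : 0 < i) : G.deg i ≤ G.pos :=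
  le_iSup (fun i : {i : ℤ // 0 < i} => G.deg i) ⟨i, hi⟩

/-- The projection of `M` onto `M_{>0}` along the components of degree `≤ 0`. -/
noncomputable def posProj (G : GrMod R M) : M →ₗ[R] G.pos :=
  G.byDegree fun i => if hi : 0 < i then Submodule.inclusion (G.deg_le_pos hi) else 0

theorem posProj_coe (G : GrMod R M) (v : G.pos) : G.posProj v = v := by
  obtain ⟨v, hv⟩ := v
  apply Subtype.ext
  induction hv using Submodule.iSup_induction' with
  | mem i x hx => simp [posProj, G.byDegree_apply _ hx, i.2]
  | zero => simp
  | add x y _ _ hx hy => simp_all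

/-! ## The tensor coalgebra of the desuspension of `M_{>0}`

The underlying module is the tensor algebra on `M_{>0}`; the word `[ā₁|…|āₙ]` is the product of the
letters `ι aᵢ`, and the letter `ā` has degree `|a| - 1`. The multiplication of the tensor algebra is
only used as concatenation of words. -/

/-- The tensor module `T(s⁻¹ M_{>0})`. -/
abbrev Bar (G : GrMod R M) := TensorAlgebra R G.pos

/-- `IsWord n x`: `x` is a word `[ā₁|…|āₖ]` with homogeneous letters and `n = ∑ (|aᵢ| - 1)`. -/
inductive IsWord (G : GrMod R M) : ℤ → G.Bar → Prop
  | nil : IsWord G 0 1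
  | cons {i n : ℤ} {v : G.pos} {x : G.Bar} (hi : 0 < i) (hv : (v : M) ∈ G.deg i)
      (hx : IsWord G n x) : IsWord G (i - 1 + n) (TensorAlgebra.ι R v * x)

/-- The component of degree `n` of `T(s⁻¹ M_{>0})`. -/
def barDeg (G : GrMod R M) (n : ℤ) : Submodule R G.Bar := Submodule.span R {x | G.IsWord n x}

theorem IsWord.mul {G : GrMod R M} {m n : ℤ} {x y : G.Bar} (hx : G.IsWord m x)
    (hy : G.IsWord n y) : G.IsWord (m + n) (x * y) := by
  induction hx with
  | nil => simpa using hy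
  | cons hi hv _ ih => rw [mul_assoc, add_assoc]; exact .cons hi hv ih

theorem IsWord.letter {G : GrMod R M} {i : ℤ} {v : G.pos} (hi : 0 < i) (hv : (v : M) ∈ G.deg i) :
    G.IsWord (i - 1) (TensorAlgebra.ι R v) := by
  simpa using IsWord.cons hi hv .nil

instance barDeg_gradedMonoid (G : GrMod R M) : SetLike.GradedMonoid G.barDeg where
  one_mem := Submodule.subset_span .nil
  mul_mem i j x y hx hy := by
    have h := Submodule.mul_mem_mul hx hy
    rw [barDeg, barDeg, Submodule.span_mul_span] at h
    refine Submodule.span_mono ?_ h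
    rintro _ ⟨a, ha, b, hb, rfl⟩
    exact IsWord.mul ha hb

/-- Auxiliary: the decomposition of a letter into letters of homogeneous elements. -/
noncomputable def barSplit (G : GrMod R M) : M →ₗ[R] ⨁ n, G.barDeg n :=
  G.byDegree fun i => if hi : 0 < i then
    DirectSum.lof R ℤ (fun n => G.barDeg n) (i - 1) ∘ₗ
      LinearMap.codRestrict (G.barDeg (i - 1))
        (TensorAlgebra.ι R ∘ₗ Submodule.inclusion (G.deg_le_pos hi))
        (fun a => Submodule.subset_span (IsWord.letter hi a.2))
    else 0

theorem coe_barSplit (G : GrMod R M) (a : M) :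
    DirectSum.coeLinearMap G.barDeg (G.barSplit a) = TensorAlgebra.ι R (G.posProj a) := by
  have h : DirectSum.coeLinearMap G.barDeg ∘ₗ G.barSplit = TensorAlgebra.ι R ∘ₗ G.posProj := by
    refine G.ext_deg fun i a ha => ?_
    by_cases hi : 0 < i
    · simp [barSplit, posProj, G.byDegree_apply _ ha, hi]
      rfl
    · simp [barSplit, posProj, G.byDegree_apply _ ha, hi]
  exact LinearMap.congr_fun h a

theorem barDeg_internal (G : GrMod R M) : DirectSum.IsInternal G.barDeg := by
  let F : G.Bar →ₐ[R] ⨁ n, G.barDeg n := TensorAlgebra.lift R (G.barSplit ∘ₗ G.pos.subtype)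
  have hw : ∀ n x (hx : G.IsWord n x),
      F x = DirectSum.of (fun n => G.barDeg n) n ⟨x, Submodule.subset_span hx⟩ := by
    intro n x hx
    induction hx with
    | nil => exact map_one F
    | @cons i n v x hi hv hx ih =>
      rw [map_mul, ih]
      have : F (TensorAlgebra.ι R v) = DirectSum.of (fun n => G.barDeg n) (i - 1)
          ⟨TensorAlgebra.ι R v, Submodule.subset_span (IsWord.letter hi hv)⟩ := by
        simp only [F, TensorAlgebra.lift_ι_apply, LinearMap.comp_apply, Submodule.subtype_apply,
          barSplit, G.byDegree_apply _ hv, hi, dif_pos]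
        rfl
      rw [this, DirectSum.of_mul_of]
      rfl
  let _ : GradedAlgebra G.barDeg := GradedAlgebra.ofAlgHom G.barDeg F
    (by
      ext v
      have := G.coe_barSplit v
      rw [posProj_coe] at this
      simp only [F, AlgHom.toLinearMap_apply, LinearMap.comp_apply, AlgHom.comp_apply,
        TensorAlgebra.lift_ι_apply, AlgHom.id_apply, Submodule.subtype_apply]
      exact this)
    (by
      rintro n ⟨x, hx⟩
      induction hx using Submodule.span_induction with
      | mem x hx => exact hw n x hx
      | zero => rw [map_zero]; exact (map_zero (DirectSum.of (fun n => G.barDeg n) n)).symm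
      | add x y hx hy h1 h2 =>
        simp only [map_add] at h1 h2 ⊢
        rw [h1, h2, ← map_add]; rfl
      | smul r x hx h =>
        simp only [map_smul] at h ⊢
        rw [h]
        exact ((DirectSum.lof R ℤ (fun n => G.barDeg n) n).map_smul r ⟨x, hx⟩).symm)
  exact DirectSum.Decomposition.isInternal G.barDeg

/-- `T(s⁻¹ M_{>0})` as a graded module. -/
def bar (G : GrMod R M) : GrMod R G.Bar := ⟨G.barDeg, G.barDeg_internal⟩

/-- The word `[ā]` of length one; elements of degree `≤ 0` are sent to `0`. -/
noncomputable def letter (G : GrMod R M) : M →ₗ[R] G.Bar := TensorAlgebra.ι R ∘ₗ G.posProj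

/-- Recursion on the first letter: `wordRec n₀ s t` sends the empty word to `n₀` and `[v]·x` to
`s v x + t v (wordRec n₀ s t x)`. -/
noncomputable def wordRec (G : GrMod R M) (n₀ : P) (s : G.pos →ₗ[R] G.Bar →ₗ[R] P)
    (t : G.pos →ₗ[R] P →ₗ[R] P) : G.Bar →ₗ[R] P :=
  LinearMap.snd R G.Bar P ∘ₗ LinearMap.applyₗ ((1 : G.Bar), n₀) ∘ₗ
    (TensorAlgebra.lift R (M := G.pos) (A := Module.End R (G.Bar × P))
      { toFun := fun v =>
          (LinearMap.mulLeft R (TensorAlgebra.ι R v) ∘ₗ LinearMap.fst R G.Bar P).prod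
            ((s v).coprod (t v))
        map_add' := fun v w => by
          ext <;> simp [add_mul]
        map_smul' := fun r v => by
          ext <;> simp }).toLinearMap

theorem wordRec_one (G : GrMod R M) (n₀ : P) (s : G.pos →ₗ[R] G.Bar →ₗ[R] P)
    (t : G.pos →ₗ[R] P →ₗ[R] P) : G.wordRec n₀ s t 1 = n₀ := by
  simp [wordRec]

theorem wordRec_ι_mul (G : GrMod R M) (n₀ : P) (s : G.pos →ₗ[R] G.Bar →ₗ[R] P)
    (t : G.pos →ₗ[R] P →ₗ[R] P) (v : G.pos) (x : G.Bar) :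
    G.wordRec n₀ s t (TensorAlgebra.ι R v * x) = s v x + t v (G.wordRec n₀ s t x) := by
  have key : ∀ (L : G.Bar →ₐ[R] Module.End R (G.Bar × P)),
      (∀ v p, (L (TensorAlgebra.ι R v) p).1 = TensorAlgebra.ι R v * p.1) →
      ∀ x p, (L x p).1 = x * p.1 := by
    intro L hL x
    induction x using TensorAlgebra.induction with
    | algebraMap r => intro p; simp [Algebra.algebraMap_eq_smul_one]
    | ι v => exact hL v
    | mul a b ha hb => intro p; simp [ha, hb, mul_assoc]
    | add a b ha hb => intro p; simp [ha, hb, add_mul]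
  simp only [wordRec, LinearMap.comp_apply, AlgHom.toLinearMap_apply, map_mul]
  simp only [LinearMap.applyₗ_apply_apply, Module.End.mul_apply, TensorAlgebra.lift_ι_apply,
    LinearMap.coe_mk, AddHom.coe_mk, LinearMap.snd_apply, LinearMap.prod_apply, Function.prod_apply,
    LinearMap.coprod_apply]
  rw [key]
  · simp
  · intro v p
    simp

/-- The counit of `T(s⁻¹ M_{>0})`. -/
noncomputable def counit (G : GrMod R M) : G.Bar →ₗ[R] R :=
  (TensorAlgebra.algebraMapInv (R := R) (M := G.pos)).toLinearMap

/-- The deconcatenation coproduct `Δ[ā₁|…|āₙ] = ∑ [ā₁|…|āᵢ] ⊗ [āᵢ₊₁|…|āₙ]`: it is given by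
`Δ 1 = 1 ⊗ 1` and `Δ([v]·x) = 1 ⊗ [v]·x + ([v] ⊗ 1)·Δ x`. -/
noncomputable def comul (G : GrMod R M) : G.Bar →ₗ[R] G.Bar ⊗[R] G.Bar :=
  G.wordRec (1 ⊗ₜ 1)
    ((LinearMap.mul R G.Bar).compr₂ (TensorProduct.mk R G.Bar G.Bar 1) ∘ₗ TensorAlgebra.ι R)
    (LinearMap.mul R (G.Bar ⊗[R] G.Bar) ∘ₗ (TensorProduct.mk R G.Bar G.Bar).flip 1 ∘ₗ
      TensorAlgebra.ι R)

/-- The projection `[ā] ↦ a` of degree `1` onto the words of length one. -/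
noncomputable def univ (G : GrMod R M) : G.Bar →ₗ[R] M :=
  G.wordRec 0 ((LinearMap.lsmul R M).flip.compl₂ G.counit ∘ₗ G.pos.subtype) 0

/-- The coproduct `(1 ⊗ T ⊗ 1)(Δ ⊗ Δ)` of the tensor square of `T(s⁻¹ M_{>0})`, where `T` is the
interchange map with Koszul sign. -/
noncomputable def comul₂ (G : GrMod R M) :
    G.Bar ⊗[R] G.Bar →ₗ[R] (G.Bar ⊗[R] G.Bar) ⊗[R] (G.Bar ⊗[R] G.Bar) :=
  (TensorProduct.assoc R G.Bar G.Bar (G.Bar ⊗[R] G.Bar)).symm.toLinearMap ∘ₗ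
    LinearMap.lTensor G.Bar ((TensorProduct.assoc R G.Bar G.Bar G.Bar).toLinearMap ∘ₗ
      LinearMap.rTensor G.Bar (G.bar.swap G.bar) ∘ₗ
      (TensorProduct.assoc R G.Bar G.Bar G.Bar).symm.toLinearMap) ∘ₗ
    (TensorProduct.assoc R G.Bar G.Bar (G.Bar ⊗[R] G.Bar)).toLinearMap ∘ₗ
    TensorProduct.map G.comul G.comul

/-- The linear map that is `f n` on words of length `n`. -/
noncomputable def byLength (G : GrMod R M) (f : ℕ → G.Bar →ₗ[R] P) : G.Bar →ₗ[R] P :=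
  DirectSum.toModule R ℕ P (fun n => f n ∘ₗ TensorPower.toTensorAlgebra) ∘ₗ
    (TensorAlgebra.toDirectSum (R := R) (M := G.pos)).toLinearMap

end GrMod

/-! ## Differential graded algebras -/

/-- The data `(deg, d, mul, one)` on the module `A` form a differential graded algebra with
differential of degree `+1`. -/
structure IsDGA {R A : Type*} [CommRing R] [AddCommGroup A] [Module R A]
    (deg : ℤ → Submodule R A) (d : A →ₗ[R] A) (mul : A →ₗ[R] A →ₗ[R] A) (one : A) : Prop where
  internal : DirectSum.IsInternal deg
  one_mem : one ∈ deg 0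
  mul_mem : ∀ i j, ∀ a ∈ deg i, ∀ b ∈ deg j, mul a b ∈ deg (i + j)
  one_mul : ∀ a, mul one a = a
  mul_one : ∀ a, mul a one = a
  mul_assoc : ∀ a b c, mul (mul a b) c = mul a (mul b c)
  d_mem : ∀ i, ∀ a ∈ deg i, d a ∈ deg (i + 1)
  d_d : ∀ a, d (d a) = 0
  leibniz : ∀ i, ∀ a ∈ deg i, ∀ b, d (mul a b) = mul (d a) b + i.negOnePow • mul a (d b)

/-- A differential graded algebra over `R` with underlying module `A`. -/
structure DGA (R A : Type*) [CommRing R] [AddCommGroup A] [Module R A] where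
  deg : ℤ → Submodule R A
  d : A →ₗ[R] A
  mul : A →ₗ[R] A →ₗ[R] A
  one : A
  isDGA : IsDGA deg d mul one

namespace DGA

variable {R A : Type*} [CommRing R] [AddCommGroup A] [Module R A]

/-- The underlying graded module. -/
def gr (D : DGA R A) : GrMod R A := ⟨D.deg, D.isDGA.internal⟩

/-- `A` is non-negatively graded, `A⁰ = R` via the unit, and `A¹ = 0`. -/
structure IsOneReduced (D : DGA R A) : Prop where
  neg : ∀ i < 0, D.deg i = ⊥
  zero : ∀ a ∈ D.deg 0, ∃! r : R, r • D.one = a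
  one : D.deg 1 = ⊥

/-- The bar construction `BA`. -/
abbrev Bar (D : DGA R A) := D.gr.Bar

/-- The map `a ⊗ x ↦ ∑ a φ(x') ⊗ x''` of `A ⊗ BA`, where `φ : BA → A` is the universal twisting
cochain; explicitly `a ⊗ [ā₁|…|āₙ] ↦ a a₁ ⊗ [ā₂|…|āₙ]`, and `a ⊗ 1 ↦ 0`. -/
noncomputable def cap (D : DGA R A) : A ⊗[R] D.Bar →ₗ[R] A ⊗[R] D.Bar :=
  LinearMap.rTensor D.Bar (TensorProduct.lift D.mul) ∘ₗ
    (TensorProduct.assoc R A A D.Bar).symm.toLinearMap ∘ₗ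
    LinearMap.lTensor A (LinearMap.rTensor D.Bar D.gr.univ ∘ₗ D.gr.comul)

/-- The map `a ⊗ [ā₁|…|āₙ] ↦ [b̄|ā₂|…|āₙ]` with `b = a a₁`. -/
noncomputable def merge (D : DGA R A) : A ⊗[R] D.Bar →ₗ[R] D.Bar :=
  LinearMap.mul' R D.Bar ∘ₗ LinearMap.rTensor D.Bar D.gr.letter ∘ₗ D.cap

/-- The differential of the bar construction: with `εᵢ = ∑_{j<i} (|aⱼ| - 1)`,
`d[ā₁|…|āₙ] = -∑ᵢ (-1)^εᵢ [ā₁|…|\overline{d aᵢ}|…|āₙ]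
  - ∑_{i≥2} (-1)^εᵢ [ā₁|…|\overline{aᵢ₋₁ aᵢ}|…|āₙ]`.
Recursively, `d 1 = 0` and
`d([v̄]·x) = -[\overline{dv}]·x - (-1)^(|v|-1) merge (v ⊗ x) + (-1)^(|v|-1) [v̄]·d x`. -/
noncomputable def barD (D : DGA R A) : D.Bar →ₗ[R] D.Bar :=
  D.gr.wordRec 0
    (-(LinearMap.mul R D.Bar ∘ₗ D.gr.letter ∘ₗ D.d ∘ₗ D.gr.pos.subtype) +
      TensorProduct.curry D.merge ∘ₗ D.gr.sgn ∘ₗ D.gr.pos.subtype)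
    (-(LinearMap.mul R D.Bar ∘ₗ D.gr.letter ∘ₗ D.gr.sgn ∘ₗ D.gr.pos.subtype))

/-- The differential `d ⊗ 1 + 1 ⊗ d` (with Koszul sign) of `BA ⊗ BA`. -/
noncomputable def barD₂ (D : DGA R A) : D.Bar ⊗[R] D.Bar →ₗ[R] D.Bar ⊗[R] D.Bar :=
  TensorProduct.map D.barD LinearMap.id + TensorProduct.map D.gr.bar.sgn D.barD

/-- The product `f ⌣ g = μ (f ⊗ g) Δ` of two maps `BA ⊗ BA → A` with `g` of degree `1`; the Koszul
sign is `(f ⊗ g) (z ⊗ w) = (-1) ^ |z| f z ⊗ g w`. -/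
noncomputable def cup (D : DGA R A) (f g : D.Bar ⊗[R] D.Bar →ₗ[R] A) :
    D.Bar ⊗[R] D.Bar →ₗ[R] A :=
  TensorProduct.lift D.mul ∘ₗ
    TensorProduct.map (f ∘ₗ TensorProduct.map D.gr.bar.sgn D.gr.bar.sgn) g ∘ₗ D.gr.comul₂

/-- The differential of the acyclic bar construction `B(A;A) = A ⊗ BA`,
`d (a ⊗ x) = da ⊗ x + (-1)^|a| a ⊗ dx - (-1)^|a| ∑ a φ(x') ⊗ x''`. -/
noncomputable def acyclicD (D : DGA R A) : A ⊗[R] D.Bar →ₗ[R] A ⊗[R] D.Bar :=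
  TensorProduct.map D.d LinearMap.id + TensorProduct.map D.gr.sgn D.barD -
    D.cap ∘ₗ TensorProduct.map D.gr.sgn LinearMap.id

/-! ### Operations `E_{k,1}`

In this section `E k a b` is `E_{k,1}(a₁, …, aₖ; b)`, with `E 0` standing for `E_{0,1}`. -/

/-- The map `x ⊗ b ↦ E_{k,1}(a₁, …, aₖ; b)` for `x = [ā₁|…|āₖ]`. -/
noncomputable def opBar (D : DGA R A)
    (E : ∀ k : ℕ, MultilinearMap R (fun _ : Fin k => A) (A →ₗ[R] A)) :
    D.Bar →ₗ[R] A →ₗ[R] A :=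
  DirectSum.toModule R ℕ (A →ₗ[R] A) (fun k =>
      PiTensorProduct.lift ((E k).compLinearMap fun _ => D.gr.pos.subtype)) ∘ₗ
    (TensorAlgebra.toDirectSum (R := R) (M := D.gr.pos)).toLinearMap

/-- The homomorphism `E : BA ⊗ BA → A` of degree `1` with
`E([ā₁|…|āₚ] ⊗ [b̄₁|…|b̄_q]) = E_{p,q}(a₁, …, aₚ; b₁, …, b_q)`, where `E_{k,1}` is the given family,
`E_{1,0} = id`, and all other `E_{p,q}` vanish. -/
noncomputable def hgaE (D : DGA R A)
    (E : ∀ k : ℕ, MultilinearMap R (fun _ : Fin k => A) (A →ₗ[R] A)) :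
    D.Bar ⊗[R] D.Bar →ₗ[R] A :=
  TensorProduct.lift ((D.opBar E).compl₂ D.gr.univ +
    ((LinearMap.lsmul R A).flip ∘ₗ D.gr.univ).compl₂ D.gr.counit)

/-- The component of the comultiplicative extension of a map `f : BA ⊗ BA → A` that lies in words of
length `n`: the iterated coproduct into `n` tensor factors followed by `(s⁻¹ f)^{⊗ n}`. -/
noncomputable def extComponent (D : DGA R A) (f : D.Bar ⊗[R] D.Bar →ₗ[R] A) :
    ℕ → D.Bar ⊗[R] D.Bar →ₗ[R] D.Bar
  | 0 => (LinearMap.toSpanSingleton R D.Bar 1) ∘ₗ LinearMap.mul' R R ∘ₗ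
      TensorProduct.map D.gr.counit D.gr.counit
  | n + 1 => LinearMap.mul' R D.Bar ∘ₗ
      TensorProduct.map (D.gr.letter ∘ₗ f) (D.extComponent f n) ∘ₗ D.gr.comul₂

/-- The comultiplicative extension `μ_E : BA ⊗ BA → BA` of `E`, the sum over `n` of its components in
words of length `n`. As `E (1 ⊗ 1) = 0`, the components with `n > p + q` vanish on `x ⊗ y` when
`x` and `y` are words of length `p` and `q`. -/
noncomputable def barMul (D : DGA R A)
    (E : ∀ k : ℕ, MultilinearMap R (fun _ : Fin k => A) (A →ₗ[R] A)) :
    D.Bar →ₗ[R] D.Bar →ₗ[R] D.Bar :=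
  D.gr.byLength fun p => (D.gr.byLength fun q =>
    (∑ n ∈ Finset.range (p + q + 1), TensorProduct.curry (D.extComponent (D.hgaE E) n)).flip).flip

/-- The map `BA ⊗ A → A ⊗ BA`,
`[ā₁|…|āₙ] ⊗ b ↦ ∑ₖ (-1)^s E_{k,1}(a₁, …, aₖ; b) ⊗ [āₖ₊₁|…|āₙ]` with
`s = |b| (|āₖ₊₁| + ⋯ + |āₙ|) + |ā₁| + ⋯ + |āₖ|`. -/
noncomputable def smash (D : DGA R A)
    (E : ∀ k : ℕ, MultilinearMap R (fun _ : Fin k => A) (A →ₗ[R] A)) :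
    D.Bar ⊗[R] A →ₗ[R] A ⊗[R] D.Bar :=
  LinearMap.rTensor D.Bar (TensorProduct.lift (D.opBar E ∘ₗ D.gr.bar.sgn)) ∘ₗ
    (TensorProduct.assoc R D.Bar A D.Bar).symm.toLinearMap ∘ₗ
    LinearMap.lTensor D.Bar (D.gr.bar.swap D.gr) ∘ₗ
    (TensorProduct.assoc R D.Bar D.Bar A).toLinearMap ∘ₗ
    LinearMap.rTensor A D.gr.comul

/-- The twisted multiplication of `A ⊗ BA`: the product of `a₀ ⊗ [ā₁|…|āₙ]` and `b₀ ⊗ y` is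
`∑ₖ (-1)^s a₀ E_{k,1}(a₁, …, aₖ; b₀) ⊗ ([āₖ₊₁|…|āₙ] ∘ y)`, where `∘` is the multiplication `μ_E` and
`s = |b₀| (|āₖ₊₁| + ⋯ + |āₙ|) + |ā₁| + ⋯ + |āₖ|`. -/
noncomputable def twistedMul (D : DGA R A)
    (E : ∀ k : ℕ, MultilinearMap R (fun _ : Fin k => A) (A →ₗ[R] A)) :
    A ⊗[R] D.Bar →ₗ[R] A ⊗[R] D.Bar →ₗ[R] A ⊗[R] D.Bar :=
  TensorProduct.curry
    (TensorProduct.map (TensorProduct.lift D.mul) (TensorProduct.lift (D.barMul E)) ∘ₗ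
      (TensorProduct.assoc R A A (D.Bar ⊗[R] D.Bar)).symm.toLinearMap ∘ₗ
      LinearMap.lTensor A ((TensorProduct.assoc R A D.Bar D.Bar).toLinearMap ∘ₗ
        LinearMap.rTensor D.Bar (D.smash E) ∘ₗ
        (TensorProduct.assoc R D.Bar A D.Bar).symm.toLinearMap) ∘ₗ
      (TensorProduct.assoc R A D.Bar (A ⊗[R] D.Bar)).toLinearMap)

end DGA

/-- A homotopy G-algebra with underlying module `A`: a 1-reduced dga with operations `E_{p,q}` of
degree `1 - p - q`, where `E_{1,0} = E_{0,1} = id`, `E k a b` is `E_{k,1}(a₁, …, aₖ; b)`, and the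
other operations vanish. The operations are normalized, in that `E_{k,1}(a₁, …, aₖ; 1) = 0`. -/
structure HomotopyGAlgebra (R A : Type*) [CommRing R] [AddCommGroup A] [Module R A]
    extends DGA R A where
  oneReduced : toDGA.IsOneReduced
  E : ∀ k : ℕ, MultilinearMap R (fun _ : Fin k => A) (A →ₗ[R] A)
  E_mem : ∀ (k : ℕ) (e : Fin k → ℤ) (a : Fin k → A) (j : ℤ) (b : A),
    (∀ i, a i ∈ deg (e i)) → b ∈ deg j → E k a b ∈ deg (∑ i, e i + j - k)
  E_zero : ∀ a b, E 0 a b = b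
  E_one : ∀ (k : ℕ) (a : Fin (k + 1) → A), (∀ i, a i ∈ toDGA.gr.pos) → E (k + 1) a one = 0
  /-- `E` is a twisting cochain: `dE + Ed = -E ⌣ E`. -/
  twisting : ∀ z, d (toDGA.hgaE E z) + toDGA.hgaE E (toDGA.barD₂ z) =
    -toDGA.cup (toDGA.hgaE E) (toDGA.hgaE E) z
  /-- `μ_E` is associative. -/
  barMul_assoc : ∀ x y z, toDGA.barMul E (toDGA.barMul E x y) z =
    toDGA.barMul E x (toDGA.barMul E y z)

/-! Write `x ▷ b` for the operation `[ā₁|…|āₖ] ▷ b = E_{k,1}(a₁, …, aₖ; b)`. The product on `A ⊗ BA`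
is a smash product for this action, and the theorem holds because the axioms say that `BA` is a dg
bialgebra for which `A` is, up to a controlled error in the differential, a module algebra.

The bialgebra structure: the recursion `bmul_word`, which peels off the first letter of a product,
shows that `μ_E` is a morphism of coalgebras (`comul_bmul_word`). It is a chain map
(`barD_bmul_word`) because merging two adjacent values of `E` gives `E ⌣ E`, which the twisting
condition trades for `dE + Ed`.

The action: the twisting condition at `x ⊗ [b̄|c̄]` becomes `x ▷ (bc) = ∑ ± (x' ▷ b)(x'' ▷ c)`
(`op_mul`), since no operation takes two arguments on the right. At `x ⊗ [b̄]` it computes `d (x ▷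
b)` (`d_op`); besides the expected terms there are products with the universal twisting cochain `φ`
on either side. Associativity of `μ_E`, read off on words of length one, gives `(x ∘ y) ▷ b = x ▷ (y
▷ b)` (`op_bmul`). Normalization makes the unit of `A` invariant (`op_unit`).

Associativity of the twisted product is then the usual smash product computation
(`amul_assoc_word`). For the Leibniz rule, `a ⊗ x = (a ⊗ 1)(1 ⊗ x)` and associativity leave left
multiplication by `A` (`acyclicD_lmul`), products inside `1 ⊗ BA` (`leibniz_one_tmul`) and the
products `(1 ⊗ x)(b ⊗ 1)` (`leibniz_one_tmul_tmul_one`). In the last case the error terms of `d_op`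
are exactly what the twisted part of `d_φ` produces. That `d_φ` squares to zero is an induction on
word length (`acyclicD_acyclicD`). -/

/-! ## Koszul signs as scalars -/

/-- The sign `(-1) ^ i` as an element of `R`. -/
def ksign (R : Type*) [CommRing R] (i : ℤ) : R := ((i.negOnePow : ℤ) : R)

section ksign

variable {R M : Type*} [CommRing R] [AddCommGroup M] [Module R M]

@[simp] theorem ksign_zero : ksign R 0 = 1 := by simp [ksign]

@[simp] theorem ksign_one : ksign R 1 = -1 := by simp [ksign]

theorem ksign_add (i j : ℤ) : ksign R (i + j) = ksign R i * ksign R j := by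
  simp [ksign, Int.negOnePow_add]

theorem ksign_mul_self (i : ℤ) : ksign R i * ksign R i = 1 := by
  rw [← ksign_add, ksign, Int.negOnePow_even _ ⟨i, rfl⟩]
  simp

theorem ksign_congr {i j : ℤ} (h : Even (i - j)) : ksign R i = ksign R j := by
  rw [ksign, ksign, (Int.negOnePow_eq_iff i j).2 h]

theorem negOnePow_smul (i : ℤ) (x : M) : i.negOnePow • x = ksign R i • x := by
  rw [ksign, Int.cast_smul_eq_zsmul, Units.smul_def]

end ksign

/-! ## Sums over the splittings of a list -/

section splitSum

variable {α β P Q : Type*} [AddCommMonoid P] [AddCommMonoid Q]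

/-- The sum of `F p q` over all `p`, `q` with `p ++ q` equal to the given list. -/
def splitSum : List α → (List α → List α → P) → P
  | [], F => F [] []
  | a :: u, F => F [] (a :: u) + splitSum u fun p q => F (a :: p) q

theorem splitSum_nil (F : List α → List α → P) : splitSum [] F = F [] [] := rfl

theorem splitSum_cons (a : α) (u : List α) (F : List α → List α → P) :
    splitSum (a :: u) F = F [] (a :: u) + splitSum u fun p q => F (a :: p) q := rfl

/-- The equation `p ++ q = u` is available for the summands because Koszul signs are compared
through `wdeg u = wdeg p + wdeg q`. -/
theorem splitSum_congr {u : List α} {F G : List α → List α → P}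
    (h : ∀ p q, p ++ q = u → F p q = G p q) : splitSum u F = splitSum u G := by
  induction u generalizing F G with
  | nil => exact h [] [] rfl
  | cons a u ih =>
    rw [splitSum_cons, splitSum_cons, h [] (a :: u) rfl,
      ih fun p q hpq => h (a :: p) q (by rw [List.cons_append, hpq])]

theorem splitSum_zero (u : List α) : splitSum u (fun _ _ => (0 : P)) = 0 := by
  induction u with
  | nil => rfl
  | cons a u ih => rw [splitSum_cons, ih, add_zero]

theorem splitSum_add (u : List α) (F G : List α → List α → P) :
    splitSum u (fun p q => F p q + G p q) = splitSum u F + splitSum u G := by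
  induction u generalizing F G with
  | nil => rfl
  | cons a u ih => rw [splitSum_cons, ih, splitSum_cons, splitSum_cons, add_add_add_comm]

theorem map_splitSum {𝓕 : Type*} [FunLike 𝓕 P Q] [AddMonoidHomClass 𝓕 P Q] (f : 𝓕) (u : List α)
    (F : List α → List α → P) : f (splitSum u F) = splitSum u fun p q => f (F p q) := by
  induction u generalizing F with
  | nil => rfl
  | cons a u ih => rw [splitSum_cons, map_add, ih, splitSum_cons]

theorem splitSum_sum {ι : Type*} (s : Finset ι) (u : List α) (F : ι → List α → List α → P) :
    splitSum u (fun p q => ∑ i ∈ s, F i p q) = ∑ i ∈ s, splitSum u (F i) := by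
  induction u generalizing F with
  | nil => rfl
  | cons a u ih => rw [splitSum_cons, ih, ← Finset.sum_add_distrib]; rfl

theorem splitSum_comm (u : List α) (v : List β) (F : List α → List α → List β → List β → P) :
    splitSum u (fun p q => splitSum v fun r s => F p q r s) =
      splitSum v fun r s => splitSum u fun p q => F p q r s := by
  induction u generalizing F with
  | nil => rfl
  | cons a u ih => rw [splitSum_cons, ih, ← splitSum_add]; rfl

/-- Coassociativity of deconcatenation: either order of cutting runs over all ways to cut `u` into
three consecutive pieces. -/
theorem splitSum_assoc (u : List α) (F : List α → List α → List α → P) :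
    splitSum u (fun p q => splitSum p fun p₁ p₂ => F p₁ p₂ q) =
      splitSum u fun p q => splitSum q fun q₁ q₂ => F p q₁ q₂ := by
  induction u generalizing F with
  | nil => rfl
  | cons a u ih =>
    simp only [splitSum_cons, splitSum_nil, splitSum_add, ih]
    rw [add_assoc]

theorem splitSum_smul {S : Type*} [DistribSMul S P] (c : S) (u : List α)
    (F : List α → List α → P) : splitSum u (fun p q => c • F p q) = c • splitSum u F :=
  (map_splitSum (DistribSMul.toAddMonoidHom P c) u F).symm

theorem splitSum_mem {S : Type*} [SetLike S P] [AddSubmonoidClass S P] (s : S) {u : List α}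
    {F : List α → List α → P} (h : ∀ p q, p ++ q = u → F p q ∈ s) : splitSum u F ∈ s := by
  induction u generalizing F with
  | nil => exact h [] [] rfl
  | cons a u ih =>
    exact add_mem (h _ _ rfl) (ih fun p q hpq => h (a :: p) q (by rw [List.cons_append, hpq]))

theorem splitSum_neg {P : Type*} [AddCommGroup P] (u : List α) (F : List α → List α → P) :
    splitSum u (fun p q => -F p q) = -splitSum u F :=
  (map_splitSum (negAddMonoidHom : P →+ P) u F).symm

theorem splitSum_sub {P : Type*} [AddCommGroup P] (u : List α) (F G : List α → List α → P) :
    splitSum u (fun p q => F p q - G p q) = splitSum u F - splitSum u G := by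
  simp only [sub_eq_add_neg, splitSum_add, splitSum_neg]

/-- Only the splitting with empty left part contributes to the sum. -/
theorem splitSum_eq_left {u : List α} {F : List α → List α → P}
    (h : ∀ a p q, F (a :: p) q = 0) : splitSum u F = F [] u := by
  cases u with
  | nil => rfl
  | cons a u => simp only [splitSum_cons, h, splitSum_zero, add_zero]

/-- Only the splitting with empty right part contributes to the sum. -/
theorem splitSum_eq_right {u : List α} {F : List α → List α → P}
    (h : ∀ p b q, F p (b :: q) = 0) : splitSum u F = F u [] := by
  induction u generalizing F with
  | nil => rfl
  | cons a u ih => rw [splitSum_cons, h, zero_add, ih fun p b q => h _ b q]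

/-- The sum of `F p r q s` over all `p ++ q = u` and `r ++ s = v`. -/
def splitSum₂ (u : List α) (v : List β) (F : List α → List β → List α → List β → P) : P :=
  splitSum u fun p q => splitSum v fun r s => F p r q s

theorem splitSum₂_congr {u : List α} {v : List β} {F G : List α → List β → List α → List β → P}
    (h : ∀ p r q s, p ++ q = u → r ++ s = v → F p r q s = G p r q s) :
    splitSum₂ u v F = splitSum₂ u v G :=
  splitSum_congr fun p q hu => splitSum_congr fun r s hv => h p r q s hu hv

theorem splitSum₂_add (u : List α) (v : List β) (F G : List α → List β → List α → List β → P) :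
    splitSum₂ u v (fun p r q s => F p r q s + G p r q s) = splitSum₂ u v F + splitSum₂ u v G := by
  simp only [splitSum₂, splitSum_add]

theorem splitSum₂_neg {P : Type*} [AddCommGroup P] (u : List α) (v : List β)
    (F : List α → List β → List α → List β → P) :
    splitSum₂ u v (fun p r q s => -F p r q s) = -splitSum₂ u v F := by
  simp only [splitSum₂, splitSum_neg]

theorem splitSum₂_smul {S : Type*} [DistribSMul S P] (c : S) (u : List α) (v : List β)
    (F : List α → List β → List α → List β → P) :
    splitSum₂ u v (fun p r q s => c • F p r q s) = c • splitSum₂ u v F := by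
  simp only [splitSum₂, splitSum_smul]

theorem map_splitSum₂ {𝓕 : Type*} [FunLike 𝓕 P Q] [AddMonoidHomClass 𝓕 P Q] (f : 𝓕)
    (u : List α) (v : List β) (F : List α → List β → List α → List β → P) :
    f (splitSum₂ u v F) = splitSum₂ u v fun p r q s => f (F p r q s) := by
  simp only [splitSum₂, map_splitSum]

theorem splitSum₂_mem {S : Type*} [SetLike S P] [AddSubmonoidClass S P] (T : S) {u : List α}
    {v : List β} {F : List α → List β → List α → List β → P}
    (h : ∀ p r q s, p ++ q = u → r ++ s = v → F p r q s ∈ T) : splitSum₂ u v F ∈ T :=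
  splitSum_mem T fun p q hu => splitSum_mem T fun r s hv => h p r q s hu hv

/-- Coassociativity for pairs of words. No signs occur here; they are part of the summand `F`. -/
theorem splitSum₂_assoc (u : List α) (v : List β)
    (F : List α → List β → List α → List β → List α → List β → P) :
    splitSum₂ u v (fun p r q s => splitSum₂ p r fun p₁ r₁ p₂ r₂ => F p₁ r₁ p₂ r₂ q s) =
      splitSum₂ u v fun p r q s => splitSum₂ q s fun q₁ s₁ q₂ s₂ => F p r q₁ s₁ q₂ s₂ := by
  simp only [splitSum₂]
  calc _ = splitSum u fun p q => splitSum p fun p₁ p₂ => splitSum v fun r s =>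
          splitSum r fun r₁ r₂ => F p₁ r₁ p₂ r₂ q s := by
        refine splitSum_congr fun p q _ => ?_
        rw [splitSum_comm]
    _ = _ := by
        rw [splitSum_assoc u fun p₁ p₂ q => splitSum v fun r s =>
          splitSum r fun r₁ r₂ => F p₁ r₁ p₂ r₂ q s]
        exact splitSum_congr fun p q _ =>
          (splitSum_congr fun q₁ q₂ _ => splitSum_assoc v fun r s₁ s₂ => F p r q₁ s₁ q₂ s₂).trans
            (splitSum_comm q v _)

section TensorProduct

variable {R M N : Type*} [CommRing R] [AddCommGroup M] [Module R M] [AddCommGroup N] [Module R N]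

theorem splitSum_tmul (u : List α) (F : List α → List α → M) (n : N) :
    splitSum u F ⊗ₜ[R] n = splitSum u fun p q => F p q ⊗ₜ[R] n :=
  map_splitSum ((TensorProduct.mk R M N).flip n) u F

theorem tmul_splitSum (u : List α) (F : List α → List α → N) (m : M) :
    m ⊗ₜ[R] splitSum u F = splitSum u fun p q => m ⊗ₜ[R] F p q :=
  map_splitSum (TensorProduct.mk R M N m) u F

theorem splitSum₂_tmul (u : List α) (v : List β) (F : List α → List β → List α → List β → M)
    (n : N) : splitSum₂ u v F ⊗ₜ[R] n = splitSum₂ u v fun p r q s => F p r q s ⊗ₜ[R] n :=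
  map_splitSum₂ ((TensorProduct.mk R M N).flip n) u v F

theorem tmul_splitSum₂ (u : List α) (v : List β) (F : List α → List β → List α → List β → N)
    (m : M) : m ⊗ₜ[R] splitSum₂ u v F = splitSum₂ u v fun p r q s => m ⊗ₜ[R] F p r q s :=
  map_splitSum₂ (TensorProduct.mk R M N m) u v F

end TensorProduct

theorem mul_splitSum {S : Type*} [NonUnitalNonAssocSemiring S] (u : List α)
    (F : List α → List α → S) (x : S) : x * splitSum u F = splitSum u fun p q => x * F p q :=
  map_splitSum (AddMonoidHom.mulLeft x) u F

theorem mul_splitSum₂ {S : Type*} [NonUnitalNonAssocSemiring S] (u : List α) (v : List β)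
    (F : List α → List β → List α → List β → S) (x : S) :
    x * splitSum₂ u v F = splitSum₂ u v fun p r q s => x * F p r q s :=
  map_splitSum₂ (AddMonoidHom.mulLeft x) u v F

end splitSum

/-! ## Words -/

namespace GrMod

variable {R M N P : Type*} [CommRing R] [AddCommGroup M] [Module R M] [AddCommGroup N] [Module R N]
  [AddCommMonoid P] [Module R P]

theorem sgn_apply' (G : GrMod R M) {i : ℤ} {a : M} (ha : a ∈ G.deg i) :
    G.sgn a = ksign R i • a := by
  rw [G.sgn_apply ha, negOnePow_smul (R := R)]

theorem swap_tmul' (G : GrMod R M) (H : GrMod R N) {i j : ℤ} {x : M} {y : N}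
    (hx : x ∈ G.deg i) (hy : y ∈ H.deg j) :
    G.swap H (x ⊗ₜ y) = ksign R (i * j) • (y ⊗ₜ x) := by
  rw [G.swap_tmul H hx hy, negOnePow_smul (R := R)]

/-- A homogeneous element of positive degree, together with its degree. -/
structure Letter (G : GrMod R M) where
  deg : ℤ
  val : M
  pos : 0 < deg
  mem : val ∈ G.deg deg

variable {G : GrMod R M}

/-- A letter as an element of `M_{>0}`. -/
def Letter.toPos (a : G.Letter) : G.pos := ⟨a.val, G.deg_le_pos a.pos a.mem⟩

/-- The word `[ā₁|…|āₙ]`. -/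
noncomputable def word : List G.Letter → G.Bar
  | [] => 1
  | a :: u => TensorAlgebra.ι R a.toPos * word u

/-- The degree `∑ (|aᵢ| - 1)` of the word `[ā₁|…|āₙ]`. -/
def wdeg : List G.Letter → ℤ
  | [] => 0
  | a :: u => a.deg - 1 + wdeg u

@[simp] theorem word_nil : word ([] : List G.Letter) = 1 := rfl

@[simp] theorem wdeg_nil : wdeg ([] : List G.Letter) = 0 := rfl

theorem wdeg_cons (a : G.Letter) (u : List G.Letter) : wdeg (a :: u) = a.deg - 1 + wdeg u := rfl

theorem wdeg_append (u v : List G.Letter) : wdeg (u ++ v) = wdeg u + wdeg v := by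
  induction u with
  | nil => simp
  | cons a u ih => rw [List.cons_append, wdeg_cons, ih, wdeg_cons, add_assoc]

theorem wdeg_nonneg (u : List G.Letter) : 0 ≤ wdeg u := by
  induction u with
  | nil => exact le_rfl
  | cons a u ih => have := a.pos; rw [wdeg_cons]; omega

theorem posProj_of_mem {i : ℤ} (hi : 0 < i) {a : M} (ha : a ∈ G.deg i) :
    G.posProj a = ⟨a, G.deg_le_pos hi ha⟩ :=
  G.posProj_coe ⟨a, G.deg_le_pos hi ha⟩

theorem letter_coe (v : G.pos) : G.letter (v : M) = TensorAlgebra.ι R v := by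
  rw [letter, LinearMap.comp_apply, posProj_coe]

@[simp] theorem Letter.coe_toPos (a : G.Letter) : (a.toPos : M) = a.val := rfl

theorem letter_val (a : G.Letter) : G.letter a.val = TensorAlgebra.ι R a.toPos :=
  letter_coe a.toPos

theorem word_cons (a : G.Letter) (u : List G.Letter) :
    word (a :: u) = G.letter a.val * word u := by
  rw [letter_val]; rfl

theorem word_isWord (u : List G.Letter) : G.IsWord (wdeg u) (word u) := by
  induction u with
  | nil => exact .nil
  | cons a u ih => exact .cons a.pos a.mem ih

theorem word_mem (u : List G.Letter) : word u ∈ G.bar.deg (wdeg u) :=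
  Submodule.subset_span (word_isWord u)

theorem IsWord.exists_word {n : ℤ} {x : G.Bar} (hx : G.IsWord n x) :
    ∃ u : List G.Letter, wdeg u = n ∧ word u = x := by
  induction hx with
  | nil => exact ⟨[], rfl, rfl⟩
  | @cons i n v x hi hv hx ih =>
    obtain ⟨u, rfl, rfl⟩ := ih
    exact ⟨⟨i, v, hi, hv⟩ :: u, rfl, rfl⟩

theorem barDeg_le_iff (n : ℤ) (S : Submodule R G.Bar) :
    G.bar.deg n ≤ S ↔ ∀ u : List G.Letter, wdeg u = n → word u ∈ S := by
  constructor
  · rintro h u rfl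
    exact h (word_mem u)
  · intro h
    refine Submodule.span_le.2 fun x hx => ?_
    obtain ⟨u, hu, rfl⟩ := IsWord.exists_word hx
    exact h u hu

theorem ext_word {f g : G.Bar →ₗ[R] P} (h : ∀ u : List G.Letter, f (word u) = g (word u)) :
    f = g := by
  refine G.bar.ext_deg fun n => ?_
  change G.bar.deg n ≤ LinearMap.eqLocus f g
  exact (barDeg_le_iff n _).2 fun u _ => h u

theorem letter_mem {i : ℤ} (hi : 0 < i) {a : M} (ha : a ∈ G.deg i) :
    G.letter a ∈ G.bar.deg (i - 1) := by
  rw [show a = (⟨a, G.deg_le_pos hi ha⟩ : G.pos) from rfl, letter_coe]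
  exact Submodule.subset_span (IsWord.letter hi ha)

theorem bar_mul_mem {m n : ℤ} {x y : G.Bar} (hx : x ∈ G.bar.deg m) (hy : y ∈ G.bar.deg n) :
    x * y ∈ G.bar.deg (m + n) :=
  SetLike.mul_mem_graded (A := G.barDeg) hx hy

@[simp] theorem counit_one : G.counit 1 = 1 := by simp [counit]

@[simp] theorem counit_letter_mul (a : M) (x : G.Bar) : G.counit (G.letter a * x) = 0 := by
  simp [counit, letter, TensorAlgebra.algebraMapInv]

@[simp] theorem counit_word_cons (a : G.Letter) (u : List G.Letter) :
    G.counit (word (a :: u)) = 0 := by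
  rw [word_cons, counit_letter_mul]

@[simp] theorem comul_one : G.comul 1 = 1 ⊗ₜ 1 := G.wordRec_one _ _ _

theorem comul_letter_mul (a : M) (x : G.Bar) :
    G.comul (G.letter a * x) = 1 ⊗ₜ (G.letter a * x) + (G.letter a ⊗ₜ 1) * G.comul x :=
  G.wordRec_ι_mul _ _ _ (G.posProj a) x

theorem comul_word (u : List G.Letter) :
    G.comul (word u) = splitSum u fun p q => word p ⊗ₜ word q := by
  induction u with
  | nil => simp [splitSum_nil]
  | cons a u ih =>
    rw [word_cons, comul_letter_mul, ih, splitSum_cons,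
      mul_splitSum]
    simp [word_cons]

@[simp] theorem univ_one : G.univ 1 = 0 := G.wordRec_one _ _ _

theorem univ_letter_mul (a : M) (x : G.Bar) :
    G.univ (G.letter a * x) = G.counit x • (G.posProj a : M) := by
  refine (G.wordRec_ι_mul _ _ _ (G.posProj a) x).trans ?_
  simp

theorem univ_word_cons (a : G.Letter) (u : List G.Letter) :
    G.univ (word (a :: u)) = G.counit (word u) • a.val := by
  rw [word_cons, univ_letter_mul, ← a.coe_toPos, posProj_coe]

@[simp] theorem univ_word_singleton (a : G.Letter) : G.univ (word [a]) = a.val := by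
  simp [univ_word_cons]

@[simp] theorem univ_word_cons_cons (a b : G.Letter) (u : List G.Letter) :
    G.univ (word (a :: b :: u)) = 0 := by
  simp [univ_word_cons]

theorem univ_word_mem (u : List G.Letter) : G.univ (word u) ∈ G.deg (wdeg u + 1) := by
  match u with
  | [] => simp
  | [a] => simpa [wdeg_cons] using a.mem
  | a :: b :: u => simp

/-- `(x₁ ⊗ x₂) ⊗ (y₁ ⊗ y₂) ↦ (x₁ ⊗ y₁) ⊗ (x₂ ⊗ y₂)` with Koszul sign. -/
noncomputable def midSwap (G : GrMod R M) : (G.Bar ⊗[R] G.Bar) ⊗[R] (G.Bar ⊗[R] G.Bar) →ₗ[R]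
    (G.Bar ⊗[R] G.Bar) ⊗[R] (G.Bar ⊗[R] G.Bar) :=
  (TensorProduct.assoc R G.Bar G.Bar (G.Bar ⊗[R] G.Bar)).symm.toLinearMap ∘ₗ
    LinearMap.lTensor G.Bar ((TensorProduct.assoc R G.Bar G.Bar G.Bar).toLinearMap ∘ₗ
      LinearMap.rTensor G.Bar (G.bar.swap G.bar) ∘ₗ
      (TensorProduct.assoc R G.Bar G.Bar G.Bar).symm.toLinearMap) ∘ₗ
    (TensorProduct.assoc R G.Bar G.Bar (G.Bar ⊗[R] G.Bar)).toLinearMap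

theorem midSwap_tmul {i j : ℤ} (x₁ y₂ : G.Bar) {x₂ y₁ : G.Bar} (hx : x₂ ∈ G.bar.deg i)
    (hy : y₁ ∈ G.bar.deg j) : G.midSwap ((x₁ ⊗ₜ x₂) ⊗ₜ (y₁ ⊗ₜ y₂)) =
      ksign R (i * j) • ((x₁ ⊗ₜ y₁) ⊗ₜ (x₂ ⊗ₜ y₂)) := by
  simp [midSwap, G.bar.swap_tmul' G.bar hx hy, TensorProduct.smul_tmul']

theorem comul₂_tmul (x y : G.Bar) :
    G.comul₂ (x ⊗ₜ y) = G.midSwap (G.comul x ⊗ₜ G.comul y) := rfl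

/-- If the coproducts of `x` and `y` are sums over splittings, so is the coproduct of `x ⊗ y`. -/
theorem midSwap_splitSum {α β : Type*} (u : List α) (v : List β) 
    (X : List α → List α → G.Bar ⊗[R] G.Bar) (Y : List β → List β → G.Bar ⊗[R] G.Bar) :
    G.midSwap (splitSum u X ⊗ₜ splitSum v Y) =
      splitSum₂ u v fun p r q s => G.midSwap (X p q ⊗ₜ Y r s) := by
  simp only [splitSum_tmul, tmul_splitSum, map_splitSum, splitSum₂]
  exact splitSum_comm _ _ _

theorem comul₂_word (u v : List G.Letter) : G.comul₂ (word u ⊗ₜ word v) =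
    splitSum₂ u v fun p r q s =>
      ksign R (wdeg q * wdeg r) • ((word p ⊗ₜ word r) ⊗ₜ (word q ⊗ₜ word s)) := by
  rw [comul₂_tmul, comul_word, comul_word, midSwap_splitSum]
  simp only [midSwap_tmul _ _ (word_mem _) (word_mem _)]

end GrMod

/-! ### Words as pure tensors -/

namespace GrMod

variable {R M P : Type*} [CommRing R] [AddCommGroup M] [Module R M] [AddCommMonoid P] [Module R P]
  {G : GrMod R M}

/-- Maps defined by word length, such as `byLength` and `opBar`, factor through tensor powers; this
identification allows them to be evaluated on words. -/
theorem word_eq_tprod (u : List G.Letter) :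
    word u = TensorAlgebra.tprod R G.pos u.length fun i => (u.get i).toPos := by
  rw [TensorAlgebra.tprod_apply]
  induction u with
  | nil => simp
  | cons a u ih =>
    rw [List.ofFn_succ, List.prod_cons, word, ih]
    rfl

theorem toDirectSum_word (u : List G.Letter) : TensorAlgebra.toDirectSum (word u) =
    DirectSum.lof R ℕ (fun n => ⨂[R]^n G.pos) u.length
      (PiTensorProduct.tprod R fun i => (u.get i).toPos) := by
  rw [word_eq_tprod, TensorAlgebra.toDirectSum_tensorPower_tprod, DirectSum.lof_eq_of]

theorem byLength_word (f : ℕ → G.Bar →ₗ[R] P) (u : List G.Letter) :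
    G.byLength f (word u) = f u.length (word u) := by
  rw [byLength, LinearMap.comp_apply, AlgHom.toLinearMap_apply, toDirectSum_word,
    DirectSum.toModule_lof, LinearMap.comp_apply, TensorPower.toTensorAlgebra_tprod,
    ← word_eq_tprod]

theorem word_induction {p : G.Bar → Prop} (zero : p 0) (add : ∀ x y, p x → p y → p (x + y))
    (smul : ∀ (r : R) x, p x → p (r • x)) (word : ∀ u : List G.Letter, p (word u)) (x : G.Bar) :
    p x := by
  have hx : x ∈ ⨆ i, G.bar.deg i := by
    rw [G.bar.internal.submodule_iSup_eq_top]; trivial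
  have h : ⨆ i, G.bar.deg i ≤
      ({ carrier := {x | p x}, zero_mem' := zero, add_mem' := add _ _, smul_mem' := smul } :
        Submodule R G.Bar) :=
    iSup_le fun n => (barDeg_le_iff n _).2 fun u _ => word u
  exact h hx

end GrMod

/-! ### The bar differential as a coderivation -/

namespace DGA

open GrMod

variable {R A : Type*} [CommRing R] [AddCommGroup A] [Module R A] (D : DGA R A)

theorem d_one : D.d D.one = 0 := by
  have h := D.isDGA.leibniz 0 D.one D.isDGA.one_mem D.one
  rw [D.isDGA.one_mul, D.isDGA.mul_one, D.isDGA.one_mul] at h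
  simpa using h

theorem leibniz' {i : ℤ} {a : A} (ha : a ∈ D.deg i) (b : A) :
    D.d (D.mul a b) = D.mul (D.d a) b + ksign R i • D.mul a (D.d b) := by
  rw [D.isDGA.leibniz i a ha b, negOnePow_smul (R := R)]

theorem cap_tmul (a : A) (x : D.Bar) :
    D.cap (a ⊗ₜ x) = TensorProduct.map (D.mul a ∘ₗ D.gr.univ) LinearMap.id (D.gr.comul x) := by
  simp only [cap, LinearMap.comp_apply, LinearMap.lTensor_tmul]
  induction D.gr.comul x with
  | zero => simp
  | add s t hs ht => simp only [map_add, TensorProduct.tmul_add, hs, ht]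
  | tmul y z => simp

theorem cap_tmul_word (a : A) (u : List D.gr.Letter) :
    D.cap (a ⊗ₜ word u) = splitSum u fun p q => D.mul a (D.gr.univ (word p)) ⊗ₜ word q := by
  rw [cap_tmul, comul_word, map_splitSum]
  simp

@[simp] theorem cap_tmul_one (a : A) : D.cap (a ⊗ₜ 1) = 0 := by
  simp [cap_tmul]

theorem cap_tmul_letter_mul (a b : A) (x : D.Bar) :
    D.cap (a ⊗ₜ (D.gr.letter b * x)) = D.mul a (D.gr.posProj b) ⊗ₜ x := by
  revert x
  refine fun x => word_induction (p := fun x => D.cap (a ⊗ₜ (D.gr.letter b * x)) =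
    D.mul a (D.gr.posProj b) ⊗ₜ x) (by simp) (fun x y hx hy => ?_) (fun r x hx => ?_) (fun u => ?_) x
  · simp only [mul_add, TensorProduct.tmul_add, map_add, hx, hy]
  · simp only [mul_smul_comm, TensorProduct.tmul_smul, map_smul, hx]
  · rw [cap_tmul, comul_letter_mul, comul_word, mul_splitSum, map_add, map_splitSum]
    simp only [Algebra.TensorProduct.tmul_mul_tmul, one_mul, TensorProduct.map_tmul,
      LinearMap.comp_apply, univ_letter_mul, LinearMap.id_apply, univ_one, map_zero,
      TensorProduct.zero_tmul, zero_add]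
    rw [splitSum_eq_left (by simp)]
    simp

theorem merge_tmul (a : A) (x : D.Bar) : D.merge (a ⊗ₜ x) =
    LinearMap.mul' R D.Bar (LinearMap.rTensor D.Bar D.gr.letter (D.cap (a ⊗ₜ x))) := rfl

@[simp] theorem merge_tmul_one (a : A) : D.merge (a ⊗ₜ 1) = 0 := by
  simp [merge_tmul]

theorem merge_tmul_letter_mul (a b : A) (x : D.Bar) :
    D.merge (a ⊗ₜ (D.gr.letter b * x)) = D.gr.letter (D.mul a (D.gr.posProj b)) * x := by
  simp [merge_tmul, cap_tmul_letter_mul]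

theorem merge_tmul_word_cons (a : A) (b : D.gr.Letter) (u : List D.gr.Letter) :
    D.merge (a ⊗ₜ word (b :: u)) = D.gr.letter (D.mul a b.val) * word u := by
  rw [word_cons, merge_tmul_letter_mul, ← b.coe_toPos, posProj_coe]

/-- A merged word can be cut before its first letter or anywhere after it, but not inside it.
Accordingly, the summand with `p` empty is zero. -/
theorem comul_merge_word (a : A) (u : List D.gr.Letter) : D.gr.comul (D.merge (a ⊗ₜ word u)) =
    1 ⊗ₜ D.merge (a ⊗ₜ word u) + splitSum u fun p q => D.merge (a ⊗ₜ word p) ⊗ₜ word q := by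
  cases u with
  | nil => simp [splitSum_nil]
  | cons b u =>
    simp only [splitSum_cons, merge_tmul_word_cons, comul_letter_mul, comul_word, mul_splitSum,
      word_nil, merge_tmul_one, TensorProduct.zero_tmul, zero_add]
    simp

@[simp] theorem barD_one : D.barD 1 = 0 := D.gr.wordRec_one _ _ _

theorem barD_letter_mul {i : ℤ} (hi : 0 < i) {a : A} (ha : a ∈ D.deg i) (x : D.Bar) :
    D.barD (D.gr.letter a * x) = -(D.gr.letter (D.d a) * x) + ksign R i • D.merge (a ⊗ₜ x) -
      ksign R i • (D.gr.letter a * D.barD x) := by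
  have ha' : a ∈ D.gr.deg i := ha
  refine (D.gr.wordRec_ι_mul _ _ _ (D.gr.posProj a) x).trans ?_
  rw [posProj_of_mem hi ha']
  simp [D.gr.sgn_apply' ha', barD, sub_eq_add_neg]

theorem d_mem_gr {i : ℤ} {a : A} (ha : a ∈ D.gr.deg i) : D.d a ∈ D.gr.deg (i + 1) :=
  D.isDGA.d_mem i a ha

theorem mul_mem_gr {i j : ℤ} {a b : A} (ha : a ∈ D.gr.deg i) (hb : b ∈ D.gr.deg j) :
    D.mul a b ∈ D.gr.deg (i + j) :=
  D.isDGA.mul_mem i j a ha b hb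

theorem barD_word_mem (u : List D.gr.Letter) : D.barD (word u) ∈ D.gr.bar.deg (wdeg u + 1) := by
  induction u with
  | nil => simp
  | cons a u ih =>
    have h0 := a.pos
    rw [word_cons, D.barD_letter_mul a.pos a.mem]
    refine sub_mem (add_mem (neg_mem ?_) (Submodule.smul_mem _ _ ?_)) (Submodule.smul_mem _ _ ?_)
    · convert bar_mul_mem (letter_mem (by omega) (D.d_mem_gr a.mem)) (word_mem u) using 2
      rw [wdeg_cons]; ring
    · cases u with
      | nil => simp
      | cons b u =>
        have h1 := b.pos
        rw [merge_tmul_word_cons]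
        convert bar_mul_mem (letter_mem (by omega) (D.mul_mem_gr a.mem b.mem)) (word_mem u) using 2
        rw [wdeg_cons, wdeg_cons]; ring
    · convert bar_mul_mem (letter_mem a.pos a.mem) ih using 2
      rw [wdeg_cons]; ring

/-- The coderivation property. By induction on the first letter: each of the three terms of `barD`
is compatible with peeling off that letter, the merging term by `comul_merge_word`. -/
theorem comul_barD_word (u : List D.gr.Letter) : D.gr.comul (D.barD (word u)) =
    splitSum u fun p q => D.barD (word p) ⊗ₜ word q +
      ksign R (wdeg p) • (word p ⊗ₜ D.barD (word q)) := by
  induction u with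
  | nil => simp [splitSum_nil]
  | cons a u ih =>
    simp only [splitSum_cons, word_nil, barD_one, TensorProduct.zero_tmul, zero_add, wdeg_nil,
      ksign_zero, one_smul, word_cons, D.barD_letter_mul a.pos a.mem, map_add, map_sub, map_neg,
      map_smul, comul_letter_mul, ih, mul_splitSum, comul_merge_word, comul_word,
      Algebra.TensorProduct.tmul_mul_tmul, one_mul, TensorProduct.add_tmul, TensorProduct.sub_tmul,
      TensorProduct.neg_tmul, splitSum_add, splitSum_sub, splitSum_neg, mul_add, mul_smul_comm,
      TensorProduct.tmul_add, TensorProduct.tmul_sub, TensorProduct.tmul_neg,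
      TensorProduct.tmul_smul, ← TensorProduct.smul_tmul', splitSum_smul, wdeg_cons, ksign_add,
      sub_eq_add_neg (_ : ℤ), mul_smul]
    have h1 : ksign R (-1) = -1 := by simp [ksign]
    simp only [h1]
    module

end DGA

/-! ### The action of `BA` on `A` and the coalgebra map `μ_E` -/

namespace HomotopyGAlgebra

open GrMod

variable {R A : Type*} [CommRing R] [AddCommGroup A] [Module R A] (H : HomotopyGAlgebra R A)

/-- The operation `[ā₁|…|āₖ], b ↦ E_{k,1}(a₁, …, aₖ; b)`. -/
noncomputable abbrev op : H.Bar →ₗ[R] A →ₗ[R] A := H.toDGA.opBar H.E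

/-- The twisting cochain `E : BA ⊗ BA → A`. -/
noncomputable abbrev twist : H.Bar ⊗[R] H.Bar →ₗ[R] A := H.toDGA.hgaE H.E

/-- The multiplication `μ_E` of the bar construction. -/
noncomputable abbrev bmul : H.Bar →ₗ[R] H.Bar →ₗ[R] H.Bar := H.toDGA.barMul H.E

theorem op_word (u : List H.gr.Letter) (b : A) :
    H.op (word u) b = H.E u.length (fun i => (u.get i).val) b := by
  rw [op, DGA.opBar, LinearMap.comp_apply, AlgHom.toLinearMap_apply, toDirectSum_word,
    DirectSum.toModule_lof, PiTensorProduct.lift.tprod]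
  rfl

@[simp] theorem op_one (b : A) : H.op 1 b = b := by
  rw [← word_nil, op_word]
  exact H.E_zero _ b

/-- The degree `-k` of `E_{k,1}` is absorbed by the desuspension of its first `k` arguments, so the
action has degree zero. -/
theorem op_word_mem (u : List H.gr.Letter) {j : ℤ} {b : A} (hb : b ∈ H.gr.deg j) :
    H.op (word u) b ∈ H.gr.deg (wdeg u + j) := by
  rw [op_word]
  have h := H.E_mem u.length (fun i => (u.get i).deg) (fun i => (u.get i).val) j b
    (fun i => (u.get i).mem) hb
  have hs : ∀ u : List H.gr.Letter, ∑ i : Fin u.length, (u.get i).deg = wdeg u + u.length := by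
    intro u
    induction u with
    | nil => simp
    | cons a u ih =>
      refine (Fin.sum_univ_succ _).trans ?_
      rw [wdeg_cons, List.length_cons, Nat.cast_succ]
      rw [show ∑ i : Fin u.length, ((a :: u).get i.succ).deg = wdeg u + u.length from ih,
        List.get_cons_zero]
      ring
  rwa [hs, show wdeg u + u.length + j - u.length = wdeg u + j by ring] at h

/-- Normalization together with `E_{0,1} = id` says that the unit is invariant under the action. -/
theorem op_word_unit (u : List H.gr.Letter) :
    H.op (word u) H.one = H.gr.counit (word u) • H.one := by
  cases u with
  | nil => simp
  | cons a u =>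
    rw [counit_word_cons, zero_smul, op_word]
    exact H.E_one _ _ fun i => ((a :: u).get i).toPos.2

theorem op_unit (x : H.Bar) : H.op x H.one = H.gr.counit x • H.one :=
  LinearMap.congr_fun (ext_word (f := H.op.flip H.one)
    (g := LinearMap.toSpanSingleton R A H.one ∘ₗ H.gr.counit) H.op_word_unit) x

/-- A linear statement holds on all homogeneous elements if it holds for the unit and for the
letters. -/
theorem homogeneous_induction {p : ℤ → A → Prop} (zero : ∀ j, p j 0)
    (unit : ∀ r : R, p 0 (r • H.one)) (letter : ∀ a : H.gr.Letter, p a.deg a.val)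
    {j : ℤ} {b : A} (hb : b ∈ H.gr.deg j) : p j b := by
  -- As `A` is 1-reduced, there is nothing in negative degree and only multiples of the unit in
  -- degree zero; a homogeneous element of positive degree is a letter.
  rcases lt_trichotomy j 0 with hj | rfl | hj
  · have h : b ∈ H.deg j := hb
    rw [H.oneReduced.neg j hj, Submodule.mem_bot] at h
    exact h ▸ zero j
  · obtain ⟨r, rfl, -⟩ := H.oneReduced.zero b hb
    exact unit r
  · exact letter ⟨j, b, hj, hb⟩

theorem twist_tmul (x y : H.Bar) :
    H.twist (x ⊗ₜ y) = H.op x (H.gr.univ y) + H.gr.counit y • H.gr.univ x := by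
  simp [twist, DGA.hgaE]

@[simp] theorem twist_one_one : H.twist (1 ⊗ₜ 1) = 0 := by simp [twist_tmul]

theorem twist_word_mem (u v : List H.gr.Letter) :
    H.twist (word u ⊗ₜ word v) ∈ H.gr.deg (wdeg u + wdeg v + 1) := by
  rw [twist_tmul]
  refine add_mem ?_ ?_
  · rw [add_assoc]
    exact H.op_word_mem u (univ_word_mem v)
  · cases v with
    | nil => simpa using univ_word_mem u
    | cons b v => simp

/-- The comultiplicative extension of `E` in words of length `n`. -/
noncomputable abbrev ext (n : ℕ) : H.Bar ⊗[R] H.Bar →ₗ[R] H.Bar := H.toDGA.extComponent H.twist n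

theorem ext_zero (x y : H.Bar) : H.ext 0 (x ⊗ₜ y) = (H.gr.counit x * H.gr.counit y) • 1 := by
  simp [ext, DGA.extComponent]

theorem ext_succ_word (n : ℕ) (u v : List H.gr.Letter) : H.ext (n + 1) (word u ⊗ₜ word v) =
    splitSum₂ u v fun p r q s => ksign R (wdeg q * wdeg r) •
      (H.gr.letter (H.twist (word p ⊗ₜ word r)) * H.ext n (word q ⊗ₜ word s)) := by
  rw [ext, DGA.extComponent, LinearMap.comp_apply, LinearMap.comp_apply, comul₂_word,
    map_splitSum₂, map_splitSum₂]
  simp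

/-- Makes the inductions on total length work: the one splitting that is not shorter has both left
parts empty, and its term vanishes since `E (1 ⊗ 1) = 0`. -/
theorem append_length_lt {α β : Type*} {p q u : List α} {r s v : List β} (hu : p ++ q = u)
    (hv : r ++ s = v) (h : ¬(p = [] ∧ r = [])) : q.length + s.length < u.length + v.length := by
  subst hu hv
  simp only [← List.length_eq_zero_iff] at h
  simp only [List.length_append]
  omega

/-- Each of the `n` factors `E` must consume at least one letter. -/
theorem ext_eq_zero {n : ℕ} {u v : List H.gr.Letter} (h : u.length + v.length < n) :
    H.ext n (word u ⊗ₜ word v) = 0 := by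
  induction n generalizing u v with
  | zero => omega
  | succ n ih =>
    rw [ext_succ_word, show (0 : H.Bar) = splitSum₂ u v fun _ _ _ _ => 0 by
      simp [splitSum₂, splitSum_zero]]
    refine splitSum₂_congr fun p r q s hu hv => ?_
    by_cases hpr : p = [] ∧ r = []
    · obtain ⟨rfl, rfl⟩ := hpr
      simp
    · have := append_length_lt hu hv hpr
      rw [ih (by omega), mul_zero, smul_zero]

/-- The cutoff is left free so that one `N` serves all the shorter pairs occurring in a splitting.
-/
theorem bmul_word_eq_sum {N : ℕ} {u v : List H.gr.Letter} (h : u.length + v.length < N) :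
    H.bmul (word u) (word v) = ∑ n ∈ Finset.range N, H.ext n (word u ⊗ₜ word v) := by
  have h1 : H.bmul (word u) (word v) =
      ∑ n ∈ Finset.range (u.length + v.length + 1), H.ext n (word u ⊗ₜ word v) := by
    simp [bmul, DGA.barMul, byLength_word]
  rw [h1]
  refine Finset.sum_subset (Finset.range_mono (by omega)) fun n _ hn => ?_
  exact H.ext_eq_zero (by simpa using hn)

/-- The working form of `μ_E`: the first letter of the product is a value of `E`, and what follows
it is the product of the remaining pieces. The component of length zero gives the counit term. -/
theorem bmul_word (u v : List H.gr.Letter) : H.bmul (word u) (word v) =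
    (H.gr.counit (word u) * H.gr.counit (word v)) • 1 +
      splitSum₂ u v fun p r q s => ksign R (wdeg q * wdeg r) •
        (H.gr.letter (H.twist (word p ⊗ₜ word r)) * H.bmul (word q) (word s)) := by
  -- After the term `n = 0` is split off, the sum has `u.length + v.length` terms, which is a valid
  -- cutoff for every strictly shorter pair.
  rw [H.bmul_word_eq_sum (Nat.lt_succ_self _), Finset.sum_range_succ', ext_zero, add_comm]
  congr 1
  simp only [ext_succ_word, splitSum₂, ← splitSum_sum]
  refine splitSum₂_congr fun p r q s hu hv => ?_
  by_cases hpr : p = [] ∧ r = []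
  · obtain ⟨rfl, rfl⟩ := hpr
    simp
  · rw [H.bmul_word_eq_sum (append_length_lt hu hv hpr), Finset.mul_sum, Finset.smul_sum]

/-- Induction on the total length of two words. -/
theorem word_pair_induction {α β : Type*} {p : List α → List β → Prop}
    (h : ∀ u v, (∀ u' v', u'.length + v'.length < u.length + v.length → p u' v') → p u v)
    (u : List α) (v : List β) : p u v := by
  induction hn : u.length + v.length using Nat.strong_induction_on generalizing u v with
  | _ n ih => exact h u v fun u' v' hlt => ih _ (hn ▸ hlt) u' v' rfl

/-- The defining recursion of `μ_E` as an identity of linear maps. -/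
theorem bmul_lift : TensorProduct.lift H.bmul =
    LinearMap.toSpanSingleton R H.Bar 1 ∘ₗ LinearMap.mul' R R ∘ₗ
      TensorProduct.map H.gr.counit H.gr.counit +
    LinearMap.mul' R H.Bar ∘ₗ TensorProduct.map (H.gr.letter ∘ₗ H.twist) (TensorProduct.lift H.bmul)
      ∘ₗ H.gr.comul₂ := by
  refine TensorProduct.ext (ext_word fun u => ext_word fun v => ?_)
  simp only [LinearMap.compr₂ₛₗ_apply, TensorProduct.mk_apply, TensorProduct.lift.tmul,
    LinearMap.add_apply, LinearMap.comp_apply, comul₂_word, map_splitSum₂, H.bmul_word u v]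
  simp

theorem bmul_word_one (u : List H.gr.Letter) : H.bmul (word u) 1 = word u := by
  induction u with
  | nil =>
    rw [← word_nil, bmul_word]
    simp [splitSum₂, splitSum_nil]
  | cons a u ih =>
    rw [← word_nil, bmul_word]
    simp only [splitSum₂, splitSum_nil, splitSum_cons, twist_tmul, word_nil, univ_one, map_zero,
      counit_one, one_smul, zero_add, zero_mul, wdeg_nil, mul_zero, ksign_zero, counit_word_cons,
      zero_smul]
    rw [splitSum_eq_left (by simp), ← word_nil, univ_word_singleton, word_nil, ih, word_cons]

theorem bmul_one_word (v : List H.gr.Letter) : H.bmul 1 (word v) = word v := by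
  induction v with
  | nil => exact H.bmul_word_one []
  | cons a v ih =>
    rw [← word_nil, bmul_word]
    simp only [splitSum₂, splitSum_nil, splitSum_cons, twist_tmul, word_nil, univ_one, map_zero,
      counit_one, one_smul, zero_add, zero_mul, wdeg_nil, mul_zero, ksign_zero, counit_word_cons,
      zero_smul, op_one, add_zero]
    rw [splitSum_eq_left (by simp), univ_word_singleton, ih, word_cons]

theorem bmul_one (x : H.Bar) : H.bmul x 1 = x :=
  LinearMap.congr_fun (ext_word (f := H.bmul.flip 1) (g := LinearMap.id) H.bmul_word_one) x

theorem one_bmul (x : H.Bar) : H.bmul 1 x = x :=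
  LinearMap.congr_fun (ext_word (f := H.bmul 1) (g := LinearMap.id) H.bmul_one_word) x

theorem bmul_word_mem (u v : List H.gr.Letter) :
    H.bmul (word u) (word v) ∈ H.gr.bar.deg (wdeg u + wdeg v) := by
  induction u, v using word_pair_induction with
  | _ u v ih =>
  rw [bmul_word]
  refine add_mem ?_ (splitSum₂_mem _ fun p r q s hu hv => Submodule.smul_mem _ _ ?_)
  · cases u with
    | nil =>
      cases v with
      | nil => simpa using word_mem ([] : List H.gr.Letter)
      | cons b v => simp
    | cons a u => simp
  · by_cases hpr : p = [] ∧ r = []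
    · obtain ⟨rfl, rfl⟩ := hpr
      simp
    · have hp := wdeg_nonneg p
      have hr := wdeg_nonneg r
      convert bar_mul_mem (letter_mem (by omega) (H.twist_word_mem p r))
        (ih q s (append_length_lt hu hv hpr)) using 2
      rw [← hu, ← hv, wdeg_append, wdeg_append]
      ring

theorem counit_bmul_word (u v : List H.gr.Letter) :
    H.gr.counit (H.bmul (word u) (word v)) = H.gr.counit (word u) * H.gr.counit (word v) := by
  rw [bmul_word, map_add, map_splitSum₂]
  simp [splitSum₂, splitSum_zero]

/-- Words have nonnegative degree and `E` has degree one, so the truncation built into `letter`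
loses nothing on values of `E`. -/
theorem posProj_twist_word (u v : List H.gr.Letter) :
    (H.gr.posProj (H.twist (word u ⊗ₜ word v)) : A) = H.twist (word u ⊗ₜ word v) := by
  have hu := wdeg_nonneg u
  have hv := wdeg_nonneg v
  rw [posProj_of_mem (by omega) (H.twist_word_mem u v)]

/-- A product has length one only if nothing remains after its first letter. The counit of the
remaining product forces `q` and `s` to be empty. -/
theorem univ_bmul_word (u v : List H.gr.Letter) :
    H.gr.univ (H.bmul (word u) (word v)) = H.twist (word u ⊗ₜ word v) := by
  rw [bmul_word, map_add, map_splitSum₂]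
  simp only [map_smul, univ_letter_mul, posProj_twist_word, univ_one, smul_zero, zero_add,
    counit_bmul_word, splitSum₂]
  rw [splitSum_eq_right fun p b q => by simp [splitSum_zero],
    splitSum_eq_right fun p b q => by simp]
  simp

/-- The multiplication `μ_E` is a morphism of coalgebras. -/
theorem comul_bmul_word (u v : List H.gr.Letter) : H.gr.comul (H.bmul (word u) (word v)) =
    splitSum₂ u v fun p r q s => ksign R (wdeg q * wdeg r) •
      (H.bmul (word p) (word r) ⊗ₜ H.bmul (word q) (word s)) := by
  induction u, v using word_pair_induction with
  | _ u v ih =>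
  have hcounit : splitSum₂ u v (fun p r q s => ksign R (wdeg q * wdeg r) •
      ((H.gr.counit (word p) * H.gr.counit (word r)) • (1 : H.Bar)) ⊗ₜ[R]
        H.bmul (word q) (word s)) = 1 ⊗ₜ H.bmul (word u) (word v) := by
    rw [splitSum₂, splitSum_eq_left fun a p q => by simp [splitSum_zero],
      splitSum_eq_left fun a p q => by simp]
    simp
  -- The left tensor factor is expanded by `bmul_word` and the pieces are regrouped, so that the
  -- first letter stands in front of the same expression for the shorter pair `(q, s)`.
  have hrhs : splitSum₂ u v (fun p r q s => ksign R (wdeg q * wdeg r) •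
      (H.bmul (word p) (word r) ⊗ₜ H.bmul (word q) (word s))) =
      1 ⊗ₜ H.bmul (word u) (word v) + splitSum₂ u v fun p r q s => splitSum₂ q s fun q₁ s₁ q₂ s₂ =>
        ksign R ((wdeg q₁ + wdeg q₂) * wdeg r + wdeg q₂ * wdeg s₁) •
        ((H.gr.letter (H.twist (word p ⊗ₜ word r)) ⊗ₜ[R] (1 : H.Bar)) *
          (H.bmul (word q₁) (word s₁) ⊗ₜ H.bmul (word q₂) (word s₂))) := by
    rw [← hcounit]
    have : ∀ p r q s, H.bmul (word p) (word r) ⊗ₜ[R] H.bmul (word q) (word s) =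
      ((H.gr.counit (word p) * H.gr.counit (word r)) • (1 : H.Bar)) ⊗ₜ[R]
        H.bmul (word q) (word s) + splitSum₂ p r fun p₁ r₁ p₂ r₂ => ksign R (wdeg p₂ * wdeg r₁) •
        ((H.gr.letter (H.twist (word p₁ ⊗ₜ word r₁)) ⊗ₜ[R] (1 : H.Bar)) *
          (H.bmul (word p₂) (word r₂) ⊗ₜ H.bmul (word q) (word s))) := by
      intro p r q s
      rw [H.bmul_word p r, TensorProduct.add_tmul, splitSum₂_tmul]
      simp [TensorProduct.smul_tmul']
    rw [← splitSum₂_assoc, ← splitSum₂_add]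
    refine splitSum₂_congr fun p r q s _ _ => ?_
    rw [this, smul_add, ← splitSum₂_smul]
    congr 1
    refine splitSum₂_congr fun p₁ r₁ p₂ r₂ hp hr => ?_
    rw [← hr, smul_smul, ← ksign_add, wdeg_append]
    congr 2
    ring
  rw [hrhs, H.bmul_word u v, map_add, map_splitSum₂]
  simp only [map_smul, comul_one, comul_letter_mul, smul_add, splitSum₂_add]
  rw [← add_assoc, TensorProduct.tmul_add, tmul_splitSum₂]
  simp only [TensorProduct.tmul_smul]
  congr 1
  refine splitSum₂_congr fun p r q s hu hv => ?_
  by_cases hpr : p = [] ∧ r = []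
  · obtain ⟨rfl, rfl⟩ := hpr
    simp [splitSum₂, splitSum_zero]
  · rw [ih q s (append_length_lt hu hv hpr), mul_splitSum₂, ← splitSum₂_smul]
    refine splitSum₂_congr fun q₁ s₁ q₂ s₂ hq _ => ?_
    rw [mul_smul_comm, smul_smul, ksign_add, ← hq, wdeg_append]

end HomotopyGAlgebra

/-! ### The differential of `BA ⊗ BA` and the cup product on words -/

namespace DGA

open GrMod

variable {R A : Type*} [CommRing R] [AddCommGroup A] [Module R A] (D : DGA R A)

theorem counit_merge_word (a : A) (u : List D.gr.Letter) :
    D.gr.counit (D.merge (a ⊗ₜ word u)) = 0 := by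
  cases u with
  | nil => simp
  | cons b u => rw [merge_tmul_word_cons, counit_letter_mul]

theorem counit_barD_word (u : List D.gr.Letter) : D.gr.counit (D.barD (word u)) = 0 := by
  cases u with
  | nil => simp
  | cons a u => simp [word_cons, D.barD_letter_mul a.pos a.mem, counit_merge_word]

theorem counit_barD (x : D.Bar) : D.gr.counit (D.barD x) = 0 :=
  LinearMap.congr_fun (ext_word (f := D.gr.counit ∘ₗ D.barD) (g := 0) D.counit_barD_word) x

theorem barD₂_word (u v : List D.gr.Letter) : D.barD₂ (word u ⊗ₜ word v) =
    D.barD (word u) ⊗ₜ word v + ksign R (wdeg u) • (word u ⊗ₜ D.barD (word v)) := by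
  simp [barD₂, D.gr.bar.sgn_apply' (word_mem u), TensorProduct.smul_tmul']

/-- The coderivation property passes from `BA` to its tensor square. Each summand on the left has a
differential on one of the four pieces, and the interchange signs agree up to squares. -/
theorem comul₂_barD₂_word (u v : List D.gr.Letter) :
    D.gr.comul₂ (D.barD₂ (word u ⊗ₜ word v)) = splitSum₂ u v fun p r q s =>
      ksign R (wdeg q * wdeg r) • (D.barD₂ (word p ⊗ₜ word r) ⊗ₜ (word q ⊗ₜ word s) +
        ksign R (wdeg p + wdeg r) • ((word p ⊗ₜ word r) ⊗ₜ D.barD₂ (word q ⊗ₜ word s))) := by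
  rw [barD₂_word, map_add, map_smul, comul₂_tmul, comul₂_tmul, comul_barD_word, comul_barD_word,
    comul_word, comul_word, midSwap_splitSum, midSwap_splitSum, ← splitSum₂_smul, ← splitSum₂_add]
  refine splitSum₂_congr fun p r q s hu hv => ?_
  simp only [← hu, wdeg_append, barD₂_word, TensorProduct.add_tmul, TensorProduct.tmul_add, map_add,
    ← TensorProduct.smul_tmul', TensorProduct.tmul_smul, map_smul,
    midSwap_tmul _ _ (word_mem q) (word_mem r), midSwap_tmul _ _ (D.barD_word_mem q) (word_mem r),
    midSwap_tmul _ _ (word_mem q) (D.barD_word_mem r)]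
  simp only [add_mul, mul_add, one_mul, mul_one, ksign_add]
  have h := ksign_mul_self (R := R) (wdeg q)
  match_scalars <;> grind

theorem cup_word (f g : D.Bar ⊗[R] D.Bar →ₗ[R] A) (u v : List D.gr.Letter) :
    D.cup f g (word u ⊗ₜ word v) = splitSum₂ u v fun p r q s =>
      ksign R (wdeg q * wdeg r + wdeg p + wdeg r) •
        D.mul (f (word p ⊗ₜ word r)) (g (word q ⊗ₜ word s)) := by
  rw [cup, LinearMap.comp_apply, LinearMap.comp_apply, comul₂_word, map_splitSum₂, map_splitSum₂]
  refine splitSum₂_congr fun p r q s hu hv => ?_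
  simp only [map_smul, TensorProduct.map_tmul, LinearMap.comp_apply, TensorProduct.lift.tmul,
    D.gr.bar.sgn_apply' (word_mem _), ← TensorProduct.smul_tmul', TensorProduct.tmul_smul,
    smul_smul, ksign_add]
  congr 1
  ring

end DGA

/-! ### Consequences of the twisting condition and of associativity -/

namespace HomotopyGAlgebra

open GrMod

variable {R A : Type*} [CommRing R] [AddCommGroup A] [Module R A] (H : HomotopyGAlgebra R A)

theorem twisting_word (u v : List H.gr.Letter) :
    H.d (H.twist (word u ⊗ₜ word v)) + H.twist (H.barD₂ (word u ⊗ₜ word v)) =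
      -splitSum₂ u v fun p r q s => ksign R (wdeg q * wdeg r + wdeg p + wdeg r) •
        H.mul (H.twist (word p ⊗ₜ word r)) (H.twist (word q ⊗ₜ word s)) := by
  rw [← DGA.cup_word]
  exact H.twisting _

theorem twist_tmul_one (x : H.Bar) : H.twist (x ⊗ₜ 1) = H.gr.univ x := by simp [twist_tmul]

theorem twist_tmul_letter (x : H.Bar) (b : H.gr.Letter) :
    H.twist (x ⊗ₜ word [b]) = H.op x b.val := by simp [twist_tmul]

theorem twist_tmul_two (x : H.Bar) (b c : H.gr.Letter) :
    H.twist (x ⊗ₜ word [b, c]) = 0 := by simp [twist_tmul]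

theorem barD_letter (b : H.gr.Letter) : H.barD (word [b]) = -H.gr.letter (H.d b.val) := by
  have h := H.barD_letter_mul b.pos b.mem 1
  rw [word_cons, word_nil, h]
  simp

theorem coe_posProj {i : ℤ} (hi : 0 < i) {a : A} (ha : a ∈ H.gr.deg i) :
    (H.gr.posProj a : A) = a := by rw [posProj_of_mem hi ha]

theorem univ_barD_two (b c : H.gr.Letter) :
    H.gr.univ (H.barD (word [b, c])) = ksign R b.deg • H.mul b.val c.val := by
  have hb := b.pos
  have hc := c.pos
  rw [word_cons, H.barD_letter_mul b.pos b.mem, DGA.merge_tmul_word_cons, barD_letter]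
  simp only [map_sub, map_add, map_neg, map_smul, univ_letter_mul, mul_neg, counit_word_cons,
    word_nil, counit_one]
  rw [← mul_one (H.gr.letter (H.d c.val)), counit_letter_mul,
    H.coe_posProj (i := b.deg + c.deg) (by omega) (H.mul_mem_gr b.mem c.mem)]
  simp

/-- This is the twisting condition at `u ⊗ [b̄|c̄]`. As `E_{k,2} = 0`, only the merged letter of
`d[b̄|c̄]` survives on the left, and in `E ⌣ E` only the splittings that separate `b` from `c`. -/
theorem op_mul_letter (u : List H.gr.Letter) (b c : H.gr.Letter) :
    H.op (word u) (H.mul b.val c.val) = splitSum u fun p q => ksign R (wdeg q * b.deg) •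
      H.mul (H.op (word p) b.val) (H.op (word q) c.val) := by
  have h := H.twisting_word u [b, c]
  rw [twist_tmul_two, map_zero, zero_add, DGA.barD₂_word, map_add, twist_tmul_two, zero_add,
    map_smul, twist_tmul, DGA.counit_barD, zero_smul, add_zero, univ_barD_two] at h
  simp only [splitSum₂, splitSum_cons, splitSum_nil, twist_tmul_two, twist_tmul_letter, map_zero,
    smul_zero, word_nil, zero_add, LinearMap.zero_apply, add_zero, map_smul] at h
  -- Multiplying by the sign in front of the left-hand side isolates it, since signs square to one.
  have h' := congrArg (fun x => ksign R (wdeg u + b.deg) • x) h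
  simp only [smul_neg, ← splitSum_smul, ← splitSum_neg, smul_smul, ← ksign_add] at h'
  rw [ksign_congr (j := 0) ⟨wdeg u + b.deg, by ring⟩, ksign_zero, one_smul] at h'
  rw [h']
  refine splitSum_congr fun p q hu => ?_
  rw [← neg_smul]
  congr 1
  rw [← neg_one_mul, ← ksign_one (R := R), ← ksign_add, ← hu, wdeg_append, wdeg_cons, wdeg_nil]
  exact ksign_congr ⟨wdeg p + b.deg, by ring⟩

/-- The operations `E_{k,1}` make `A` a module algebra over the bialgebra `BA`. -/
theorem op_mul (u : List H.gr.Letter) {j : ℤ} {b : A} (hb : b ∈ H.gr.deg j) (c : A) :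
    H.op (word u) (H.mul b c) = splitSum u fun p q => ksign R (wdeg q * j) •
      H.mul (H.op (word p) b) (H.op (word q) c) := by
  suffices h : ∀ k, ∀ c ∈ H.gr.deg k, H.op (word u) (H.mul b c) =
      splitSum u fun p q => ksign R (wdeg q * j) •
        H.mul (H.op (word p) b) (H.op (word q) c) by
    have hext := H.gr.ext_deg (f := H.op (word u) ∘ₗ H.mul b) (g := splitSum u fun p q =>
      ksign R (wdeg q * j) • (H.mul (H.op (word p) b) ∘ₗ H.op (word q))) fun k c hc => by
        rw [← LinearMap.applyₗ_apply_apply c (splitSum _ _), map_splitSum]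
        exact h k c hc
    have hc := LinearMap.congr_fun hext c
    rwa [← LinearMap.applyₗ_apply_apply c (splitSum _ _), map_splitSum] at hc
  clear c
  intro k c hc
  refine H.homogeneous_induction (p := fun j b => H.op (word u) (H.mul b c) =
      splitSum u fun p q => ksign R (wdeg q * j) •
        H.mul (H.op (word p) b) (H.op (word q) c)) (by simp [splitSum_zero]) ?_ ?_ hb
  · intro r
    simp only [map_smul, LinearMap.smul_apply, H.isDGA.one_mul, op_word_unit, mul_zero, ksign_zero,
      one_smul]
    rw [splitSum_eq_left (by simp)]
    simp
  · intro b
    refine H.homogeneous_induction (p := fun _ c => H.op (word u) (H.mul b.val c) =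
      splitSum u fun p q => ksign R (wdeg q * b.deg) •
        H.mul (H.op (word p) b.val) (H.op (word q) c)) (by simp [splitSum_zero]) ?_ ?_ hc
    · intro r
      simp only [map_smul, H.isDGA.mul_one, op_word_unit]
      rw [splitSum_eq_right (by simp)]
      simp
    · exact H.op_mul_letter u b

/-- The universal twisting cochain measures the failure of `E_{k,1}` to be a chain map. -/
theorem d_op (u : List H.gr.Letter) {j : ℤ} {b : A} (hb : b ∈ H.gr.deg j) :
    H.d (H.op (word u) b) = ksign R (wdeg u) • H.op (word u) (H.d b) - H.op (H.barD (word u)) b -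
      splitSum u fun p q => ksign R (wdeg p) • H.mul (H.gr.univ (word p)) (H.op (word q) b) -
        ksign R (wdeg q * (j - 1) + wdeg p + j) • H.mul (H.op (word p) b) (H.gr.univ (word q)) := by
  refine H.homogeneous_induction (p := fun j b => H.d (H.op (word u) b) =
    ksign R (wdeg u) • H.op (word u) (H.d b) - H.op (H.barD (word u)) b -
      splitSum u fun p q => ksign R (wdeg p) • H.mul (H.gr.univ (word p)) (H.op (word q) b) -
        ksign R (wdeg q * (j - 1) + wdeg p + j) • H.mul (H.op (word p) b) (H.gr.univ (word q)))
    (by simp [splitSum_zero]) ?_ ?_ hb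
  · intro r
    rw [splitSum_sub, splitSum_eq_right (by simp [op_unit]), splitSum_eq_left (by simp [op_unit])]
    simp only [op_unit, map_smul, DGA.d_one, smul_zero, DGA.counit_barD, zero_smul, word_nil,
      counit_one, one_smul, H.isDGA.one_mul, H.isDGA.mul_one, LinearMap.smul_apply, map_zero,
      wdeg_nil]
    rw [ksign_congr (i := wdeg u * (0 - 1) + 0 + 0) (j := wdeg u) ⟨-wdeg u, by ring⟩]
    simp
  · intro b
    have hb := b.pos
    -- The two splittings of `[b̄]` in `E ⌣ E` give the two products with the universal twisting
    -- cochain.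
    have h := H.twisting_word u [b]
    rw [twist_tmul_letter, DGA.barD₂_word, map_add, twist_tmul_letter, map_smul, twist_tmul,
      DGA.counit_barD, zero_smul, add_zero, barD_letter, map_neg,
      ← mul_one (H.gr.letter (H.d b.val)), univ_letter_mul, counit_one, one_smul,
      H.coe_posProj (i := b.deg + 1) (by omega) (H.d_mem_gr b.mem), map_neg] at h
    simp only [splitSum₂, splitSum_cons, splitSum_nil, twist_tmul_letter, twist_tmul_one, word_nil,
      splitSum_add] at h
    rw [eq_sub_of_add_eq h, splitSum_sub]
    simp only [wdeg_cons, wdeg_nil, mul_zero, add_zero, zero_add]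
    -- The twisting condition has the exponent `|b̄| = |b| - 1` where the statement has `|b|`; this
    -- accounts for the minus sign between the two products.
    have : ∀ p q : List H.gr.Letter, ksign R (wdeg q * (b.deg - 1) + wdeg p + b.deg) =
        -ksign R (wdeg q * (b.deg - 1) + wdeg p + (b.deg - 1)) := by
      intro p q
      rw [← neg_one_mul, ← ksign_one (R := R), ← ksign_add]
      congr 1
      ring
    simp only [this, neg_smul, splitSum_neg]
    module

theorem univ_bmul (x y : H.Bar) : H.gr.univ (H.bmul x y) = H.twist (x ⊗ₜ y) :=
  LinearMap.congr_fun₂ (f := H.bmul.compr₂ H.gr.univ) (g := TensorProduct.curry H.twist)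
    (ext_word fun u => ext_word fun v => H.univ_bmul_word u v) x y

theorem counit_bmul (x y : H.Bar) :
    H.gr.counit (H.bmul x y) = H.gr.counit x * H.gr.counit y :=
  LinearMap.congr_fun₂ (f := H.bmul.compr₂ H.gr.counit)
    (g := (LinearMap.mul R R).compl₁₂ H.gr.counit H.gr.counit)
    (ext_word fun u => ext_word fun v => H.counit_bmul_word u v) x y

/-- The operations `E_{k,1}` make `A` a module over the algebra `BA`. -/
theorem op_bmul (x y : H.Bar) (b : A) : H.op (H.bmul x y) b = H.op x (H.op y b) := by
  refine LinearMap.congr_fun (H.gr.ext_deg (f := H.op (H.bmul x y)) (g := H.op x ∘ₗ H.op y)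
    fun j b hb => ?_) b
  refine H.homogeneous_induction (p := fun _ b => H.op (H.bmul x y) b = H.op x (H.op y b))
    (by simp) ?_ ?_ hb
  · intro r
    simp [op_unit, counit_bmul, smul_smul, mul_comm, mul_left_comm]
  · intro b
    -- The component of length one of `x ∘ [b̄]` is `x ▷ b`, so this projection of associativity is
    -- the module axiom on letters.
    have h := congrArg H.gr.univ (H.barMul_assoc x y (word [b]))
    rw [univ_bmul, univ_bmul, twist_tmul_letter, twist_tmul, univ_bmul, counit_bmul,
      twist_tmul_letter] at h
    simpa using h

theorem merge_tmul_bmul_word (a : A) (u v : List H.gr.Letter) :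
    H.merge (a ⊗ₜ H.bmul (word u) (word v)) = splitSum₂ u v fun p r q s =>
      ksign R (wdeg q * wdeg r) • (H.gr.letter (H.mul a (H.twist (word p ⊗ₜ word r))) *
        H.bmul (word q) (word s)) := by
  rw [DGA.merge_tmul, DGA.cap_tmul, comul_bmul_word, map_splitSum₂, map_splitSum₂, map_splitSum₂]
  simp [univ_bmul]

/-- The multiplication `μ_E` is a chain map. -/
theorem barD_bmul_word (u v : List H.gr.Letter) : H.barD (H.bmul (word u) (word v)) =
    TensorProduct.lift H.bmul (H.barD₂ (word u ⊗ₜ word v)) := by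
  induction u, v using word_pair_induction with
  | _ u v ih =>
  -- Merging the first letter of a product with the next one multiplies two consecutive values of
  -- `E`. After regrouping, these products sum to `-E ⌣ E`, which is `dE + Ed`.
  have hmerge : splitSum₂ u v (fun p r q s => ksign R (wdeg q * wdeg r) •
      ksign R (wdeg p + wdeg r + 1) • H.merge (H.twist (word p ⊗ₜ word r) ⊗ₜ
        H.bmul (word q) (word s))) = splitSum₂ u v fun p r q s => ksign R (wdeg q * wdeg r) •
      (H.gr.letter (H.d (H.twist (word p ⊗ₜ word r)) + H.twist (H.barD₂ (word p ⊗ₜ word r))) *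
        H.bmul (word q) (word s)) := by
    have h1 : ∀ p r q s, p ++ q = u → r ++ s = v → ksign R (wdeg q * wdeg r) •
        ksign R (wdeg p + wdeg r + 1) • H.merge (H.twist (word p ⊗ₜ word r) ⊗ₜ
          H.bmul (word q) (word s)) = splitSum₂ q s fun q₁ s₁ q₂ s₂ =>
        ksign R ((wdeg q₁ + wdeg q₂) * wdeg r + (wdeg p + wdeg r + 1) + wdeg q₂ * wdeg s₁) •
        (H.gr.letter (H.mul (H.twist (word p ⊗ₜ word r)) (H.twist (word q₁ ⊗ₜ word s₁))) *
          H.bmul (word q₂) (word s₂)) := by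
      intro p r q s _ _
      rw [merge_tmul_bmul_word, ← splitSum₂_smul, ← splitSum₂_smul]
      refine splitSum₂_congr fun q₁ s₁ q₂ s₂ hq _ => ?_
      rw [← hq, wdeg_append, smul_smul, smul_smul, ← ksign_add, ← ksign_add]
    rw [splitSum₂_congr h1, ← splitSum₂_assoc]
    refine splitSum₂_congr fun p r q s _ _ => ?_
    rw [twisting_word, map_neg, map_splitSum₂, neg_mul,
      ← LinearMap.mulRight_apply (R := R) (H.bmul (word q) (word s)), map_splitSum₂, ← splitSum₂_neg, ← splitSum₂_smul]
    refine splitSum₂_congr fun p₁ r₁ p₂ r₂ _ hr => ?_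
    rw [map_smul, map_smul, LinearMap.mulRight_apply, smul_neg, smul_smul, ← neg_smul]
    congr 1
    rw [← neg_one_mul, ← ksign_one (R := R), ← ksign_add, ← ksign_add, ← hr, wdeg_append]
    congr 1
    ring
  -- The part `dE` of the merged terms cancels the differential of the first letter. What remains is
  -- the recursion of `μ_E` applied to `barD₂`, with a shorter product inside.
  have hleft : H.barD (H.bmul (word u) (word v)) = splitSum₂ u v fun p r q s =>
      ksign R (wdeg q * wdeg r) • (H.gr.letter (H.twist (H.barD₂ (word p ⊗ₜ word r))) *
        H.bmul (word q) (word s) + ksign R (wdeg p + wdeg r) •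
          (H.gr.letter (H.twist (word p ⊗ₜ word r)) * H.barD (H.bmul (word q) (word s)))) := by
    rw [H.bmul_word u v, map_add, map_smul, DGA.barD_one, smul_zero, zero_add, map_splitSum₂]
    have h2 : ∀ p r q s, p ++ q = u → r ++ s = v → H.barD (ksign R (wdeg q * wdeg r) •
        (H.gr.letter (H.twist (word p ⊗ₜ word r)) * H.bmul (word q) (word s))) =
        ksign R (wdeg q * wdeg r) • ksign R (wdeg p + wdeg r + 1) •
          H.merge (H.twist (word p ⊗ₜ word r) ⊗ₜ H.bmul (word q) (word s)) +
        ksign R (wdeg q * wdeg r) •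
          (ksign R (wdeg p + wdeg r) •
            (H.gr.letter (H.twist (word p ⊗ₜ word r)) * H.barD (H.bmul (word q) (word s))) -
            H.gr.letter (H.d (H.twist (word p ⊗ₜ word r))) * H.bmul (word q) (word s)) := by
      intro p r q s _ _
      have hp := wdeg_nonneg p
      have hr := wdeg_nonneg r
      rw [map_smul, H.barD_letter_mul (by omega) (H.twist_word_mem p r), ksign_add _ 1, ksign_one]
      module
    rw [splitSum₂_congr h2, splitSum₂_add, hmerge, ← splitSum₂_add]
    refine splitSum₂_congr fun p r q s _ _ => ?_
    rw [map_add, add_mul]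
    module
  rw [hleft, bmul_lift, LinearMap.add_apply, LinearMap.comp_apply, LinearMap.comp_apply,
    LinearMap.comp_apply, LinearMap.comp_apply, DGA.comul₂_barD₂_word, map_splitSum₂, map_splitSum₂,
    DGA.barD₂_word]
  simp only [map_add, map_smul, TensorProduct.map_tmul, DGA.counit_barD, TensorProduct.zero_tmul,
    TensorProduct.tmul_zero, map_zero, smul_zero, zero_add, LinearMap.mul'_apply,
    LinearMap.comp_apply, add_zero]
  refine splitSum₂_congr fun p r q s hu hv => ?_
  by_cases hpr : p = [] ∧ r = []
  · obtain ⟨rfl, rfl⟩ := hpr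
    simp
  · rw [ih q s (append_length_lt hu hv hpr), TensorProduct.lift.tmul]

end HomotopyGAlgebra

/-! ### The grading of a tensor product -/

namespace GrMod

variable {R M N P : Type*} [CommRing R] [AddCommGroup M] [Module R M] [AddCommGroup N] [Module R N]
  [AddCommMonoid P] [Module R P] (G : GrMod R M) (H : GrMod R N)

theorem tmul_mem_tensorDeg {i j : ℤ} {a : M} {x : N} (ha : a ∈ G.deg i) (hx : x ∈ H.deg j) :
    a ⊗ₜ x ∈ G.tensorDeg H (i + j) := by
  refine (le_iSup (fun k : ℤ => LinearMap.range (TensorProduct.map (G.deg k).subtype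
    (H.deg (i + j - k)).subtype)) i) ⟨⟨a, ha⟩ ⊗ₜ ⟨x, ?_⟩, rfl⟩
  rwa [add_sub_cancel_left]

theorem tensorDeg_le_iff (n : ℤ) (S : Submodule R (M ⊗[R] N)) : G.tensorDeg H n ≤ S ↔
    ∀ i j, i + j = n → ∀ a ∈ G.deg i, ∀ x ∈ H.deg j, a ⊗ₜ x ∈ S := by
  constructor
  · rintro h i j rfl a ha x hx
    exact h (G.tmul_mem_tensorDeg H ha hx)
  · refine fun h => iSup_le fun i => ?_
    rintro _ ⟨t, rfl⟩
    induction t with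
    | zero => simp
    | add s t hs ht => rw [map_add]; exact add_mem hs ht
    | tmul a x => exact h i (n - i) (by ring) a a.2 x x.2

theorem tensorDeg_internal : DirectSum.IsInternal (G.tensorDeg H) := by
  let F : M ⊗[R] N →ₗ[R] ⨁ n, G.tensorDeg H n := TensorProduct.lift
    (G.byDegree fun i => LinearMap.flip (H.byDegree fun j => LinearMap.flip
      (LinearMap.mk₂ R (fun (a : G.deg i) (x : H.deg j) =>
        DirectSum.lof R ℤ (fun n => G.tensorDeg H n) (i + j)
          ⟨(a : M) ⊗ₜ (x : N), G.tmul_mem_tensorDeg H a.2 x.2⟩)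
        (fun a b x => by
          rw [← map_add]; congr 1; exact Subtype.ext (TensorProduct.add_tmul _ _ _))
        (fun r a x => by rw [← map_smul]; rfl)
        (fun a x y => by
          rw [← map_add]; congr 1; exact Subtype.ext (TensorProduct.tmul_add _ _ _))
        (fun r a x => by
          rw [← map_smul]; congr 1; exact Subtype.ext (TensorProduct.tmul_smul _ _ _)))))
  have hF : ∀ i j a (ha : a ∈ G.deg i) x (hx : x ∈ H.deg j), F (a ⊗ₜ x) =
      DirectSum.lof R ℤ (fun n => G.tensorDeg H n) (i + j)
        ⟨a ⊗ₜ x, G.tmul_mem_tensorDeg H ha hx⟩ := by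
    intro i j a ha x hx
    simp [F, G.byDegree_apply _ ha, H.byDegree_apply _ hx]
  let _ : DirectSum.Decomposition (G.tensorDeg H) := DirectSum.Decomposition.ofLinearMap _ F
    (by
      refine TensorProduct.ext (G.ext_deg fun i a ha => H.ext_deg fun j x hx => ?_)
      simp [hF i j a ha x hx])
    (by
      refine DirectSum.linearMap_ext R fun n => LinearMap.ext fun t => ?_
      -- `tensorDeg_le_iff` tests submodules of the whole tensor product, so the locus where the two
      -- maps on the component of degree `n` agree is pushed forward to it.
      have h : G.tensorDeg H n ≤ (LinearMap.eqLocus (F ∘ₗ (G.tensorDeg H n).subtype)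
          (DirectSum.lof R ℤ (fun n => G.tensorDeg H n) n)).map (G.tensorDeg H n).subtype := by
        refine (G.tensorDeg_le_iff H n _).2 ?_
        rintro i j rfl a ha x hx
        exact ⟨⟨a ⊗ₜ x, G.tmul_mem_tensorDeg H ha hx⟩, hF i j a ha x hx, rfl⟩
      obtain ⟨s, hs, hst⟩ := h t.2
      obtain rfl : s = t := Subtype.ext hst
      simpa using hs)
  exact DirectSum.Decomposition.isInternal _

/-- Two linear maps out of `M ⊗ T(s⁻¹ M_{>0})` agree if they agree on homogeneous words. -/
theorem ext_tmul_word {G : GrMod R M} {H : GrMod R N} {f g : N ⊗[R] G.Bar →ₗ[R] P}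
    (h : ∀ i, ∀ a ∈ H.deg i, ∀ u : List G.Letter, f (a ⊗ₜ word u) = g (a ⊗ₜ word u)) : f = g :=
  TensorProduct.ext (H.ext_deg fun i a ha => ext_word fun u => h i a ha u)

@[elab_as_elim]
theorem tmul_word_induction (H : GrMod R N) {G : GrMod R M} {p : N ⊗[R] G.Bar → Prop} (zero : p 0)
    (add : ∀ s t, p s → p t → p (s + t)) (smul : ∀ (r : R) t, p t → p (r • t))
    (tmul : ∀ i, ∀ a ∈ H.deg i, ∀ u : List G.Letter, p (a ⊗ₜ word u)) (t : N ⊗[R] G.Bar) : p t := by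
  let S : Submodule R (N ⊗[R] G.Bar) :=
    { carrier := {t | p t}, zero_mem' := zero, add_mem' := add _ _, smul_mem' := smul }
  -- Extensionality of linear maps, applied to the quotient by the elements satisfying `p`, becomes
  -- an induction principle.
  have h : S.mkQ = 0 := ext_tmul_word (H := H) fun i a ha u =>
    (Submodule.Quotient.mk_eq_zero S).2 (tmul i a ha u)
  exact (Submodule.Quotient.mk_eq_zero S).1 (LinearMap.congr_fun h t)

theorem tensorDeg_bar_le {G : GrMod R M} {n : ℤ} {S : Submodule R (M ⊗[R] G.Bar)}
    (h : ∀ i (u : List G.Letter), i + wdeg u = n → ∀ a ∈ G.deg i, a ⊗ₜ word u ∈ S) :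
    G.tensorDeg G.bar n ≤ S := by
  refine (G.tensorDeg_le_iff G.bar n S).2 fun i j hij a ha x hx => ?_
  have hle : G.bar.deg j ≤ S.comap (TensorProduct.mk R M G.Bar a) :=
    (barDeg_le_iff j _).2 fun u hu => h i u (hu ▸ hij) a ha
  exact hle hx

end GrMod

/-! ### The acyclic bar construction as a complex -/

namespace DGA

open GrMod

variable {R A : Type*} [CommRing R] [AddCommGroup A] [Module R A] (D : DGA R A)

theorem acyclicD_tmul {i : ℤ} {a : A} (ha : a ∈ D.gr.deg i) (x : D.Bar) :
    D.acyclicD (a ⊗ₜ x) =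
      D.d a ⊗ₜ x + ksign R i • (a ⊗ₜ D.barD x) - ksign R i • D.cap (a ⊗ₜ x) := by
  simp [acyclicD, D.gr.sgn_apply' ha, ← TensorProduct.smul_tmul']

theorem one_mem_gr : D.one ∈ D.gr.deg 0 := D.isDGA.one_mem

theorem acyclicD_one_tmul (x : D.Bar) :
    D.acyclicD (D.one ⊗ₜ x) = D.one ⊗ₜ D.barD x - D.cap (D.one ⊗ₜ x) := by
  simp [D.acyclicD_tmul D.one_mem_gr, d_one]

theorem cap_one_tmul_word (u : List D.gr.Letter) :
    D.cap (D.one ⊗ₜ word u) = splitSum u fun p q => D.gr.univ (word p) ⊗ₜ word q := by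
  simp only [cap_tmul_word, D.isDGA.one_mul]

/-- Left multiplication by `a` on the first factor of `A ⊗ BA`. -/
noncomputable abbrev lmul (a : A) : A ⊗[R] D.Bar →ₗ[R] A ⊗[R] D.Bar :=
  LinearMap.rTensor D.Bar (D.mul a)

theorem cap_mul_tmul (a b : A) (x : D.Bar) :
    D.cap (D.mul a b ⊗ₜ x) = D.lmul a (D.cap (b ⊗ₜ x)) := by
  rw [cap_tmul, cap_tmul]
  induction D.gr.comul x with
  | zero => simp
  | add s t hs ht => rw [map_add, map_add, map_add, hs, ht]
  | tmul y z => simp [D.isDGA.mul_assoc]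

/-- The parts of `d_φ` involving `barD` and `cap` commute with left multiplication up to sign, so
the rule follows from the Leibniz rule of `A`. -/
theorem acyclicD_lmul {i : ℤ} {a : A} (ha : a ∈ D.gr.deg i) (t : A ⊗[R] D.Bar) :
    D.acyclicD (D.lmul a t) = D.lmul (D.d a) t + ksign R i • D.lmul a (D.acyclicD t) := by
  have h : D.acyclicD ∘ₗ D.lmul a = D.lmul (D.d a) + ksign R i • (D.lmul a ∘ₗ D.acyclicD) := by
    refine ext_tmul_word (H := D.gr) fun j b hb u => ?_
    have hab : D.mul a b ∈ D.gr.deg (i + j) := D.mul_mem_gr ha hb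
    simp only [LinearMap.comp_apply, LinearMap.add_apply, LinearMap.smul_apply,
      LinearMap.rTensor_tmul, D.acyclicD_tmul hab, D.acyclicD_tmul hb, D.leibniz' ha, map_add,
      map_sub, map_smul, cap_mul_tmul, TensorProduct.add_tmul, ← TensorProduct.smul_tmul',
      ksign_add]
    module
  exact LinearMap.congr_fun h t

/-- The map `a ⊗ [ā₁|…|āₙ] ↦ [ā|ā₁|…|āₙ]`. -/
noncomputable def prepend : A ⊗[R] D.Bar →ₗ[R] D.Bar :=
  LinearMap.mul' R D.Bar ∘ₗ LinearMap.rTensor D.Bar D.gr.letter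

@[simp] theorem prepend_tmul (a : A) (x : D.Bar) :
    D.prepend (a ⊗ₜ x) = D.gr.letter a * x := rfl

/-- The submodule `A_{>0} ⊗ BA` of `A ⊗ BA`. -/
def posTensor : Submodule R (A ⊗[R] D.Bar) :=
  Submodule.span R {t | ∃ i : ℤ, 0 < i ∧ ∃ a ∈ D.gr.deg i, ∃ x, t = a ⊗ₜ x}

theorem tmul_mem_posTensor {i : ℤ} (hi : 0 < i) {a : A} (ha : a ∈ D.gr.deg i) (x : D.Bar) :
    a ⊗ₜ x ∈ D.posTensor :=
  Submodule.subset_span ⟨i, hi, a, ha, x, rfl⟩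

theorem acyclicD_letter_mem_posTensor (a : D.gr.Letter) (u : List D.gr.Letter) :
    D.acyclicD (a.val ⊗ₜ word u) ∈ D.posTensor := by
  have ha := a.pos
  rw [D.acyclicD_tmul a.mem]
  refine sub_mem (add_mem ?_ (Submodule.smul_mem _ _ ?_)) (Submodule.smul_mem _ _ ?_)
  · exact D.tmul_mem_posTensor (by omega) (D.d_mem_gr a.mem) _
  · exact D.tmul_mem_posTensor a.pos a.mem _
  · cases u with
    | nil => simp
    | cons b u =>
      have hb := b.pos
      rw [word_cons, cap_tmul_letter_mul, ← b.coe_toPos, posProj_coe]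
      exact D.tmul_mem_posTensor (by omega) (D.mul_mem_gr a.mem b.mem) _

/-- On words with a first letter the bar differential is the desuspension of `d_φ`. Positivity is
essential: `prepend` kills `1 ⊗ x`, but not its differential, whose `cap` part gives back `x` when
`x` is a nonempty word. -/
theorem barD_prepend {t : A ⊗[R] D.Bar} (ht : t ∈ D.posTensor) :
    D.barD (D.prepend t) = -D.prepend (D.acyclicD t) := by
  have h : D.posTensor ≤ LinearMap.eqLocus (D.barD ∘ₗ D.prepend) (-(D.prepend ∘ₗ D.acyclicD)) := by
    refine Submodule.span_le.2 ?_
    rintro _ ⟨i, hi, a, ha, x, rfl⟩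
    have hm : D.prepend (D.cap (a ⊗ₜ x)) = D.merge (a ⊗ₜ x) := rfl
    simp only [SetLike.mem_coe, LinearMap.mem_eqLocus, LinearMap.comp_apply, LinearMap.neg_apply,
      prepend_tmul, D.barD_letter_mul hi ha, D.acyclicD_tmul ha, map_add, map_sub, map_smul, hm]
    module
  exact h ht

theorem cap_tmul_prepend (a : A) {t : A ⊗[R] D.Bar} (ht : t ∈ D.posTensor) :
    D.cap (a ⊗ₜ D.prepend t) = D.lmul a t := by
  have h : D.posTensor ≤ LinearMap.eqLocus
      (D.cap ∘ₗ TensorProduct.mk R A D.Bar a ∘ₗ D.prepend) (D.lmul a) := by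
    refine Submodule.span_le.2 ?_
    rintro _ ⟨i, hi, b, hb, x, rfl⟩
    simp [cap_tmul_letter_mul, posProj_of_mem hi hb]
  exact h ht

theorem acyclicD_tmul_prepend {i : ℤ} {a : A} (ha : a ∈ D.gr.deg i) {t : A ⊗[R] D.Bar}
    (ht : t ∈ D.posTensor) : D.acyclicD (a ⊗ₜ D.prepend t) = D.d a ⊗ₜ D.prepend t -
      ksign R i • (a ⊗ₜ D.prepend (D.acyclicD t)) - ksign R i • D.lmul a t := by
  rw [D.acyclicD_tmul ha, barD_prepend D ht, cap_tmul_prepend D a ht, TensorProduct.tmul_neg]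
  module

/-- Induction on word length. For `w = b ⊗ u`, `acyclicD_tmul_prepend` writes the differential of `a
⊗ [b̄|u]` through that of `w`; in the square, all terms cancel except one containing the square
applied to `w`, where the word is shorter. The coefficient `a` must vary in the induction since `b`
takes its place. -/
theorem acyclicD_acyclicD (t : A ⊗[R] D.Bar) : D.acyclicD (D.acyclicD t) = 0 := by
  have h : D.acyclicD ∘ₗ D.acyclicD = 0 := by
    refine ext_tmul_word (H := D.gr) fun i a ha u => ?_
    rw [LinearMap.comp_apply, LinearMap.zero_apply]
    induction u generalizing i a with
    | nil => simp [D.acyclicD_tmul ha, D.acyclicD_tmul (D.d_mem_gr ha), D.isDGA.d_d]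
    | cons b u ih =>
      have hw : b.val ⊗ₜ word u ∈ D.posTensor := D.tmul_mem_posTensor b.pos b.mem _
      have hdw := D.acyclicD_letter_mem_posTensor b u
      rw [word_cons, ← prepend_tmul, D.acyclicD_tmul_prepend ha hw, map_sub, map_sub, map_smul,
        map_smul, D.acyclicD_tmul_prepend (D.d_mem_gr ha) hw, D.acyclicD_tmul_prepend ha hdw,
        ih _ _ b.mem, D.acyclicD_lmul ha, D.isDGA.d_d, map_zero, TensorProduct.zero_tmul,
        TensorProduct.tmul_zero, ksign_add, ksign_one]
      have h := ksign_mul_self (R := R) i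
      match_scalars <;> grind
  exact LinearMap.congr_fun h t

theorem acyclicD_mem {n : ℤ} {t : A ⊗[R] D.Bar} (ht : t ∈ D.gr.tensorDeg D.gr.bar n) :
    D.acyclicD t ∈ D.gr.tensorDeg D.gr.bar (n + 1) := by
  have h : D.gr.tensorDeg D.gr.bar n ≤ (D.gr.tensorDeg D.gr.bar (n + 1)).comap D.acyclicD := by
    refine tensorDeg_bar_le ?_
    rintro i u rfl a ha
    rw [Submodule.mem_comap, D.acyclicD_tmul ha, cap_tmul_word]
    refine sub_mem (add_mem ?_ (Submodule.smul_mem _ _ ?_)) (Submodule.smul_mem _ _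
      (splitSum_mem _ fun p q hu => ?_))
    · convert tmul_mem_tensorDeg _ _ (D.d_mem_gr ha) (word_mem u) using 2
      ring
    · convert tmul_mem_tensorDeg _ _ ha (D.barD_word_mem u) using 2
      ring
    · convert tmul_mem_tensorDeg _ _ (D.mul_mem_gr ha (univ_word_mem p)) (word_mem q) using 2
      rw [← hu, wdeg_append]
      ring
  exact h ht

/-- The sign operator of `A ⊗ BA`. -/
noncomputable def tensorSgn : A ⊗[R] D.Bar →ₗ[R] A ⊗[R] D.Bar :=
  TensorProduct.map D.gr.sgn D.gr.bar.sgn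

theorem tensorSgn_tmul_word {i : ℤ} {a : A} (ha : a ∈ D.gr.deg i) (u : List D.gr.Letter) :
    D.tensorSgn (a ⊗ₜ word u) = ksign R (i + wdeg u) • (a ⊗ₜ word u) := by
  rw [tensorSgn, TensorProduct.map_tmul, D.gr.sgn_apply' ha, D.gr.bar.sgn_apply' (word_mem u),
    ← TensorProduct.smul_tmul', TensorProduct.tmul_smul, smul_smul, ksign_add]

theorem tensorSgn_apply {n : ℤ} {t : A ⊗[R] D.Bar} (ht : t ∈ D.gr.tensorDeg D.gr.bar n) :
    D.tensorSgn t = ksign R n • t := by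
  have h : D.gr.tensorDeg D.gr.bar n ≤ LinearMap.eqLocus D.tensorSgn
      (ksign R n • LinearMap.id) := by
    refine tensorDeg_bar_le ?_
    rintro i u rfl a ha
    simp [D.tensorSgn_tmul_word ha]
  exact h ht

end DGA

/-! ### The smash product multiplication and its associativity -/

namespace HomotopyGAlgebra

open GrMod

variable {R A : Type*} [CommRing R] [AddCommGroup A] [Module R A] (H : HomotopyGAlgebra R A)

/-- The twisted multiplication of `A ⊗ BA`. -/
noncomputable abbrev amul : A ⊗[R] H.Bar →ₗ[R] A ⊗[R] H.Bar →ₗ[R] A ⊗[R] H.Bar :=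
  H.toDGA.twistedMul H.E

/-- The map `x ⊗ b ↦ ∑ ± (x' ▷ b) ⊗ x''` with Koszul signs. -/
noncomputable abbrev smash : H.Bar ⊗[R] A →ₗ[R] A ⊗[R] H.Bar := H.toDGA.smash H.E

/-- The map `(x' ⊗ x'') ⊗ b ↦ ± (x' ▷ b) ⊗ x''` with Koszul signs. -/
noncomputable def smashAux : (H.Bar ⊗[R] H.Bar) ⊗[R] A →ₗ[R] A ⊗[R] H.Bar :=
  LinearMap.rTensor H.Bar (TensorProduct.lift (H.op ∘ₗ H.gr.bar.sgn)) ∘ₗ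
    (TensorProduct.assoc R H.Bar A H.Bar).symm.toLinearMap ∘ₗ
    LinearMap.lTensor H.Bar (H.gr.bar.swap H.gr) ∘ₗ
    (TensorProduct.assoc R H.Bar H.Bar A).toLinearMap

theorem smash_tmul (x : H.Bar) (b : A) :
    H.smash (x ⊗ₜ b) = H.smashAux (H.gr.comul x ⊗ₜ b) := rfl

theorem smashAux_tmul {m n j : ℤ} {x y : H.Bar} {b : A} (hx : x ∈ H.gr.bar.deg m)
    (hy : y ∈ H.gr.bar.deg n) (hb : b ∈ H.gr.deg j) :
    H.smashAux ((x ⊗ₜ y) ⊗ₜ b) = ksign R (n * j + m) • (H.op x b ⊗ₜ y) := by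
  simp [smashAux, H.gr.bar.swap_tmul' H.gr hy hb, H.gr.bar.sgn_apply' hx, ksign_add, mul_smul,
    ← TensorProduct.smul_tmul']

theorem smash_word (u : List H.gr.Letter) {j : ℤ} {b : A} (hb : b ∈ H.gr.deg j) :
    H.smash (word u ⊗ₜ b) = splitSum u fun p q =>
      ksign R (wdeg q * j + wdeg p) • (H.op (word p) b ⊗ₜ word q) := by
  rw [smash_tmul, comul_word, splitSum_tmul, map_splitSum]
  exact splitSum_congr fun p q _ => H.smashAux_tmul (word_mem p) (word_mem q) hb

theorem smash_bmul_word (u v : List H.gr.Letter) {j : ℤ} {b : A} (hb : b ∈ H.gr.deg j) :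
    H.smash (H.bmul (word u) (word v) ⊗ₜ b) = splitSum₂ u v fun p r q s =>
      ksign R (wdeg q * wdeg r + ((wdeg q + wdeg s) * j + (wdeg p + wdeg r))) •
        (H.op (H.bmul (word p) (word r)) b ⊗ₜ H.bmul (word q) (word s)) := by
  rw [smash_tmul, comul_bmul_word, splitSum₂_tmul, map_splitSum₂]
  refine splitSum₂_congr fun p r q s _ _ => ?_
  rw [← TensorProduct.smul_tmul', map_smul,
    H.smashAux_tmul (H.bmul_word_mem p r) (H.bmul_word_mem q s) hb, smul_smul, ← ksign_add]

theorem smash_barD_word (u : List H.gr.Letter) {j : ℤ} {b : A} (hb : b ∈ H.gr.deg j) :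
    H.smash (H.barD (word u) ⊗ₜ b) = splitSum u fun p q =>
      ksign R (wdeg q * j + (wdeg p + 1)) • (H.op (H.barD (word p)) b ⊗ₜ word q) +
      ksign R ((wdeg q + 1) * j) • (H.op (word p) b ⊗ₜ H.barD (word q)) := by
  rw [smash_tmul, DGA.comul_barD_word, splitSum_tmul, map_splitSum]
  refine splitSum_congr fun p q _ => ?_
  rw [TensorProduct.add_tmul, ← TensorProduct.smul_tmul', map_add, map_smul,
    H.smashAux_tmul (H.barD_word_mem p) (word_mem q) hb,
    H.smashAux_tmul (word_mem p) (H.barD_word_mem q) hb, smul_smul, ← ksign_add]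
  congr 2
  exact ksign_congr ⟨wdeg p, by ring⟩

/-- Invariance of the unit kills all splittings except the one with empty left part. This makes `1 ⊗
BA` a subalgebra and `1 ⊗ [ ]` a right unit. -/
theorem smash_unit (x : H.Bar) : H.smash (x ⊗ₜ H.one) = H.one ⊗ₜ x := by
  refine LinearMap.congr_fun (ext_word (f := H.smash ∘ₗ (TensorProduct.mk R H.Bar A).flip H.one)
    (g := TensorProduct.mk R A H.Bar H.one) fun u => ?_) x
  rw [LinearMap.comp_apply, LinearMap.flip_apply, TensorProduct.mk_apply,
    H.smash_word u H.one_mem_gr, splitSum_eq_left (by simp [op_unit])]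
  simp

theorem smash_one (b : A) : H.smash (1 ⊗ₜ b) = b ⊗ₜ 1 := by
  refine LinearMap.congr_fun (H.gr.ext_deg (f := H.smash ∘ₗ TensorProduct.mk R H.Bar A 1)
    (g := (TensorProduct.mk R A H.Bar).flip 1) fun j b hb => ?_) b
  have h := H.smash_word [] hb
  simpa [splitSum_nil] using h

theorem amul_tmul (a b : A) (x y : H.Bar) : H.amul (a ⊗ₜ x) (b ⊗ₜ y) =
    TensorProduct.map (H.mul a) (H.bmul.flip y) (H.smash (x ⊗ₜ b)) := by
  simp only [amul, DGA.twistedMul, TensorProduct.curry_apply, LinearMap.comp_apply,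
    LinearEquiv.coe_coe, TensorProduct.assoc_tmul, LinearMap.lTensor_tmul,
    TensorProduct.assoc_symm_tmul, LinearMap.rTensor_tmul]
  induction H.smash (x ⊗ₜ[R] b) with
  | zero => simp
  | add s t hs ht =>
    simp only [map_add, TensorProduct.add_tmul, TensorProduct.tmul_add, hs, ht]
  | tmul c z => simp

theorem amul_tmul_word (a : A) (u : List H.gr.Letter) {j : ℤ} {b : A} (hb : b ∈ H.gr.deg j)
    (y : H.Bar) : H.amul (a ⊗ₜ word u) (b ⊗ₜ y) = splitSum u fun p q =>
      ksign R (wdeg q * j + wdeg p) • (H.mul a (H.op (word p) b) ⊗ₜ H.bmul (word q) y) := by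
  rw [amul_tmul, H.smash_word u hb, map_splitSum]
  simp

theorem amul_lmul (a : A) (s t : A ⊗[R] H.Bar) :
    H.amul (H.lmul a s) t = H.lmul a (H.amul s t) := by
  induction s with
  | zero => simp
  | add s s' hs hs' => simp only [map_add, LinearMap.add_apply, hs, hs']
  | tmul c x =>
    induction t with
    | zero => simp
    | add t t' ht ht' => simp only [map_add, ht, ht']
    | tmul b y =>
      rw [LinearMap.rTensor_tmul, amul_tmul, amul_tmul]
      induction H.smash (x ⊗ₜ[R] b) with
      | zero => simp
      | add s t hs ht => simp only [map_add, hs, ht]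
      | tmul d z => simp [H.isDGA.mul_assoc]

theorem lmul_one_tmul (a : A) (x : H.Bar) : H.lmul a (H.one ⊗ₜ x) = a ⊗ₜ x := by
  simp [H.isDGA.mul_one]

theorem one_tmul_amul (x y : H.Bar) :
    H.amul (H.one ⊗ₜ x) (H.one ⊗ₜ y) = H.one ⊗ₜ H.bmul x y := by
  rw [amul_tmul, smash_unit]
  simp [H.isDGA.mul_one]

theorem tmul_one_amul (a : A) (t : A ⊗[R] H.Bar) : H.amul (a ⊗ₜ 1) t = H.lmul a t := by
  induction t with
  | zero => simp
  | add s t hs ht => simp only [map_add, hs, ht]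
  | tmul b y =>
    rw [amul_tmul, smash_one]
    simp [one_bmul]

theorem one_tmul_amul_tmul_one (x : H.Bar) (b : A) :
    H.amul (H.one ⊗ₜ x) (b ⊗ₜ 1) = H.smash (x ⊗ₜ b) := by
  rw [amul_tmul, show H.mul H.one = LinearMap.id from LinearMap.ext H.isDGA.one_mul,
    show H.bmul.flip 1 = LinearMap.id from LinearMap.ext H.bmul_one, TensorProduct.map_id,
    LinearMap.id_apply]

theorem one_amul (t : A ⊗[R] H.Bar) : H.amul (H.one ⊗ₜ 1) t = t := by
  rw [tmul_one_amul, DGA.lmul, show H.mul H.one = LinearMap.id from LinearMap.ext H.isDGA.one_mul,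
    LinearMap.rTensor_id, LinearMap.id_apply]

theorem amul_one (t : A ⊗[R] H.Bar) : H.amul t (H.one ⊗ₜ 1) = t := by
  induction t with
  | zero => simp
  | add s t hs ht => rw [map_add, LinearMap.add_apply, hs, ht]
  | tmul a x => simp [amul_tmul, smash_unit, H.isDGA.mul_one, bmul_one]

theorem amul_mem {m n : ℤ} {s t : A ⊗[R] H.Bar} (hs : s ∈ H.gr.tensorDeg H.gr.bar m)
    (ht : t ∈ H.gr.tensorDeg H.gr.bar n) : H.amul s t ∈ H.gr.tensorDeg H.gr.bar (m + n) := by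
  have h : H.gr.tensorDeg H.gr.bar m ≤
      (H.gr.tensorDeg H.gr.bar (m + n)).comap (H.amul.flip t) := by
    refine tensorDeg_bar_le ?_
    rintro i u rfl a ha
    have h' : H.gr.tensorDeg H.gr.bar n ≤
        (H.gr.tensorDeg H.gr.bar (i + wdeg u + n)).comap (H.amul (a ⊗ₜ word u)) := by
      refine tensorDeg_bar_le ?_
      rintro j v rfl b hb
      rw [Submodule.mem_comap, H.amul_tmul_word a u hb]
      refine splitSum_mem _ fun p q hu => Submodule.smul_mem _ _ ?_
      convert tmul_mem_tensorDeg _ _ (H.mul_mem_gr ha (H.op_word_mem p hb))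
        (H.bmul_word_mem q v) using 2
      rw [← hu, wdeg_append]
      ring
    exact h' ht
  exact h hs

/-- Both sides become a sum over cuts of `u` into three pieces and of `v` into two: on the left
because `μ_E` is a coalgebra map, on the right because of the module algebra rule `op_mul`. The
summands then agree by `op_bmul` and associativity of `A` and of `μ_E`. -/
theorem amul_assoc_word (a : A) (u v : List H.gr.Letter) {j k : ℤ} {b c : A}
    (hb : b ∈ H.gr.deg j) (hc : c ∈ H.gr.deg k) (z : H.Bar) :
    H.amul (H.amul (a ⊗ₜ word u) (b ⊗ₜ word v)) (c ⊗ₜ z) =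
      H.amul (a ⊗ₜ word u) (H.amul (b ⊗ₜ word v) (c ⊗ₜ z)) := by
  have hl : H.amul (H.amul (a ⊗ₜ word u) (b ⊗ₜ word v)) (c ⊗ₜ z) =
      splitSum v fun r s => splitSum u fun p q => splitSum q fun q₁ q₂ =>
        ksign R ((wdeg q₁ + wdeg q₂) * j + wdeg p + (wdeg q₂ * wdeg r +
          ((wdeg q₂ + wdeg s) * k + (wdeg q₁ + wdeg r)))) •
        (H.mul (H.mul a (H.op (word p) b)) (H.op (H.bmul (word q₁) (word r)) c) ⊗ₜ
          H.bmul (H.bmul (word q₂) (word s)) z) := by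
    rw [H.amul_tmul_word a u hb, ← LinearMap.flip_apply, map_splitSum, splitSum_comm]
    refine splitSum_congr fun p q _ => ?_
    rw [map_smul, LinearMap.flip_apply, amul_tmul, H.smash_bmul_word q v hc, map_splitSum₂,
      ← splitSum₂_smul, splitSum_comm]
    refine splitSum₂_congr fun q₁ r q₂ s hq _ => ?_
    rw [map_smul, smul_smul, ← ksign_add, ← hq, wdeg_append]
    rfl
  rw [hl, H.amul_tmul_word b v hc, map_splitSum]
  refine splitSum_congr fun r s _ => ?_
  have hbc : H.mul b (H.op (word r) c) ∈ H.gr.deg (j + (wdeg r + k)) :=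
    H.mul_mem_gr hb (H.op_word_mem r hc)
  rw [map_smul, H.amul_tmul_word a u hbc, ← splitSum_smul, ← splitSum_assoc]
  refine splitSum_congr fun p q _ => ?_
  rw [H.op_mul p hb, map_splitSum, splitSum_tmul, ← splitSum_smul, ← splitSum_smul]
  refine splitSum_congr fun p₁ p₂ hp => ?_
  simp only [map_smul, ← TensorProduct.smul_tmul', smul_smul, ← ksign_add, op_bmul,
    H.isDGA.mul_assoc, H.barMul_assoc]
  congr 1
  rw [← hp, wdeg_append]
  congr 1
  ring

theorem amul_assoc (s t w : A ⊗[R] H.Bar) : H.amul (H.amul s t) w = H.amul s (H.amul t w) := by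
  induction s using tmul_word_induction H.gr with
  | zero => simp
  | add s s' hs hs' => simp only [map_add, LinearMap.add_apply, hs, hs']
  | smul r s hs => simp only [map_smul, LinearMap.smul_apply, hs]
  | tmul i a ha u =>
  induction t using tmul_word_induction H.gr with
  | zero => simp
  | add t t' ht ht' => simp only [map_add, LinearMap.add_apply, ht, ht']
  | smul r t ht => simp only [map_smul, LinearMap.smul_apply, ht]
  | tmul j b hb v =>
  induction w using tmul_word_induction H.gr with
  | zero => simp
  | add w w' hw hw' => simp only [map_add, hw, hw']
  | smul r w hw => simp only [map_smul, hw]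
  | tmul k c hc z => exact H.amul_assoc_word a u v hb hc (word z)

end HomotopyGAlgebra

/-! ### The Leibniz rule -/

namespace HomotopyGAlgebra

open GrMod

variable {R A : Type*} [CommRing R] [AddCommGroup A] [Module R A] (H : HomotopyGAlgebra R A)

/-- It suffices to check the Leibniz rule for left factors in `1 ⊗ BA`. -/
theorem leibniz_of_one_tmul {t : A ⊗[R] H.Bar}
    (h : ∀ u : List H.gr.Letter, H.acyclicD (H.amul (H.one ⊗ₜ word u) t) =
      H.amul (H.acyclicD (H.one ⊗ₜ word u)) t +
        ksign R (wdeg u) • H.amul (H.one ⊗ₜ word u) (H.acyclicD t)) (s : A ⊗[R] H.Bar) :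
    H.acyclicD (H.amul s t) =
      H.amul (H.acyclicD s) t + H.amul (H.tensorSgn s) (H.acyclicD t) := by
  induction s using tmul_word_induction H.gr with
  | zero => simp
  | add s s' hs hs' => simp only [map_add, LinearMap.add_apply, hs, hs']; abel
  | smul r s hs => simp only [map_smul, LinearMap.smul_apply, hs, smul_add]
  | tmul i a ha u =>
    rw [H.tensorSgn_tmul_word ha, ← H.lmul_one_tmul a, H.acyclicD_lmul ha]
    simp only [map_add, map_smul, LinearMap.add_apply, LinearMap.smul_apply, amul_lmul]
    rw [H.acyclicD_lmul ha, h u, map_add, map_smul, ksign_add]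
    module

/-- The bar differentials match because `μ_E` is a chain map. In the twisted part, the first letter
of `u ∘ v` is either the first letter of `u` or the result of a prefix of `u` acting on the first
letter of `v`; these are the twisted parts of the two terms on the right. -/
theorem leibniz_one_tmul (u v : List H.gr.Letter) :
    H.acyclicD (H.amul (H.one ⊗ₜ word u) (H.one ⊗ₜ word v)) =
      H.amul (H.acyclicD (H.one ⊗ₜ word u)) (H.one ⊗ₜ word v) +
        ksign R (wdeg u) • H.amul (H.one ⊗ₜ word u) (H.acyclicD (H.one ⊗ₜ word v)) := by
  have hcap : H.cap (H.one ⊗ₜ H.bmul (word u) (word v)) =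
      splitSum u (fun p q => H.gr.univ (word p) ⊗ₜ H.bmul (word q) (word v)) +
      splitSum₂ u v fun p r q s => ksign R (wdeg q * wdeg r) •
        (H.op (word p) (H.gr.univ (word r)) ⊗ₜ H.bmul (word q) (word s)) := by
    rw [DGA.cap_tmul, comul_bmul_word, map_splitSum₂]
    simp only [map_smul, TensorProduct.map_tmul, LinearMap.comp_apply, H.isDGA.one_mul, univ_bmul,
      twist_tmul, LinearMap.id_apply, TensorProduct.add_tmul, smul_add, splitSum₂_add]
    rw [add_comm]
    congr 1
    refine splitSum_congr fun p q _ => ?_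
    rw [splitSum_eq_left (by simp)]
    simp
  have hleft : H.amul (H.cap (H.one ⊗ₜ word u)) (H.one ⊗ₜ word v) =
      splitSum u fun p q => H.gr.univ (word p) ⊗ₜ H.bmul (word q) (word v) := by
    rw [DGA.cap_one_tmul_word, ← LinearMap.flip_apply, map_splitSum]
    refine splitSum_congr fun p q _ => ?_
    rw [LinearMap.flip_apply, ← lmul_one_tmul, amul_lmul, one_tmul_amul, lmul_one_tmul]
  have hright : ksign R (wdeg u) • H.amul (H.one ⊗ₜ word u) (H.cap (H.one ⊗ₜ word v)) =
      splitSum₂ u v fun p r q s => ksign R (wdeg q * wdeg r) •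
        (H.op (word p) (H.gr.univ (word r)) ⊗ₜ H.bmul (word q) (word s)) := by
    rw [DGA.cap_one_tmul_word, map_splitSum, splitSum₂, splitSum_comm, ← splitSum_smul]
    refine splitSum_congr fun r s _ => ?_
    rw [H.amul_tmul_word _ u (univ_word_mem r), ← splitSum_smul]
    refine splitSum_congr fun p q hu => ?_
    rw [smul_smul, ← ksign_add, H.isDGA.one_mul, ← hu, wdeg_append]
    congr 1
    exact ksign_congr ⟨wdeg p + wdeg q, by ring⟩
  rw [one_tmul_amul, DGA.acyclicD_one_tmul, DGA.acyclicD_one_tmul, DGA.acyclicD_one_tmul, hcap,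
    barD_bmul_word, DGA.barD₂_word, map_sub, map_sub, LinearMap.sub_apply, smul_sub, hleft, hright,
    one_tmul_amul, one_tmul_amul]
  simp only [map_add, map_smul, TensorProduct.lift.tmul, TensorProduct.tmul_add,
    TensorProduct.tmul_smul]
  module

/-- The Leibniz rule for `(1 ⊗ u)(b ⊗ 1)` in disguise. Of the two error terms of `d_op`, the one
with `φ` on the right cancels the `cap` part of `d_φ`; the one with `φ` on the left is the twisted
part of the differential of `1 ⊗ u`. -/
theorem acyclicD_smash_word (u : List H.gr.Letter) {j : ℤ} {b : A} (hb : b ∈ H.gr.deg j) :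
    H.acyclicD (H.smash (word u ⊗ₜ b)) = H.smash (H.barD (word u) ⊗ₜ b) -
      splitSum u (fun p q => H.lmul (H.gr.univ (word p)) (H.smash (word q ⊗ₜ b))) +
      ksign R (wdeg u) • H.smash (word u ⊗ₜ H.d b) := by
  have hleft : splitSum u (fun p q => H.lmul (H.gr.univ (word p)) (H.smash (word q ⊗ₜ b))) =
      splitSum u fun p q => splitSum p fun p₁ p₂ => ksign R (wdeg q * j + wdeg p₂) •
        (H.mul (H.gr.univ (word p₁)) (H.op (word p₂) b) ⊗ₜ word q) := by
    rw [splitSum_assoc u fun p₁ p₂ q => ksign R (wdeg q * j + wdeg p₂) •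
      (H.mul (H.gr.univ (word p₁)) (H.op (word p₂) b) ⊗ₜ[R] word q)]
    refine splitSum_congr fun p q _ => ?_
    rw [H.smash_word q hb, map_splitSum]
    simp
  have hcap : splitSum u (fun p q => ksign R (wdeg q * j + j) •
      H.cap (H.op (word p) b ⊗ₜ word q)) =
      splitSum u fun p q => splitSum p fun p₁ p₂ => ksign R ((wdeg p₂ + wdeg q) * j + j) •
        (H.mul (H.op (word p₁) b) (H.gr.univ (word p₂)) ⊗ₜ word q) := by
    rw [splitSum_assoc u fun p₁ p₂ q => ksign R ((wdeg p₂ + wdeg q) * j + j) •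
      (H.mul (H.op (word p₁) b) (H.gr.univ (word p₂)) ⊗ₜ[R] word q)]
    refine splitSum_congr fun p q _ => ?_
    rw [DGA.cap_tmul_word, ← splitSum_smul]
    exact splitSum_congr fun q₁ q₂ hq => by rw [← hq, wdeg_append]
  have hterm : ∀ p q, p ++ q = u → H.acyclicD (ksign R (wdeg q * j + wdeg p) •
      (H.op (word p) b ⊗ₜ word q)) =
      ksign R (wdeg q * j) • (H.op (word p) (H.d b) ⊗ₜ word q) +
      (ksign R (wdeg q * j + (wdeg p + 1)) • (H.op (H.barD (word p)) b ⊗ₜ word q) +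
      ksign R ((wdeg q + 1) * j) • (H.op (word p) b ⊗ₜ H.barD (word q))) -
      splitSum p (fun p₁ p₂ => ksign R (wdeg q * j + wdeg p₂) •
        (H.mul (H.gr.univ (word p₁)) (H.op (word p₂) b) ⊗ₜ word q)) +
      splitSum p (fun p₁ p₂ => ksign R ((wdeg p₂ + wdeg q) * j + j) •
        (H.mul (H.op (word p₁) b) (H.gr.univ (word p₂)) ⊗ₜ word q)) -
      ksign R (wdeg q * j + j) • H.cap (H.op (word p) b ⊗ₜ word q) := by
    intro p q _
    have h₁ : splitSum p (fun p₁ p₂ => ksign R (wdeg q * j + wdeg p₂) •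
        (H.mul (H.gr.univ (word p₁)) (H.op (word p₂) b) ⊗ₜ[R] word q)) =
        ksign R (wdeg q * j + wdeg p) • splitSum p (fun p₁ p₂ => ksign R (wdeg p₁) •
          H.mul (H.gr.univ (word p₁)) (H.op (word p₂) b)) ⊗ₜ[R] word q := by
      rw [splitSum_tmul, ← splitSum_smul]
      refine splitSum_congr fun p₁ p₂ hp => ?_
      rw [← TensorProduct.smul_tmul', smul_smul, ← ksign_add, ← hp, wdeg_append]
      congr 1
      exact ksign_congr ⟨-wdeg p₁, by ring⟩
    have h₂ : splitSum p (fun p₁ p₂ => ksign R ((wdeg p₂ + wdeg q) * j + j) •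
        (H.mul (H.op (word p₁) b) (H.gr.univ (word p₂)) ⊗ₜ[R] word q)) =
        ksign R (wdeg q * j + wdeg p) • splitSum p (fun p₁ p₂ =>
          ksign R (wdeg p₂ * (j - 1) + wdeg p₁ + j) •
          H.mul (H.op (word p₁) b) (H.gr.univ (word p₂))) ⊗ₜ[R] word q := by
      rw [splitSum_tmul, ← splitSum_smul]
      refine splitSum_congr fun p₁ p₂ hp => ?_
      rw [← TensorProduct.smul_tmul', smul_smul, ← ksign_add, ← hp, wdeg_append]
      congr 1
      exact ksign_congr ⟨-wdeg p₁, by ring⟩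
    rw [h₁, h₂, map_smul, H.acyclicD_tmul (H.op_word_mem p hb), H.d_op p hb, splitSum_sub]
    simp only [TensorProduct.sub_tmul, ← TensorProduct.smul_tmul', add_mul, one_mul, ksign_add,
      ksign_one]
    have h := ksign_mul_self (R := R) (wdeg p)
    match_scalars <;> grind
  rw [H.smash_word u hb, map_splitSum, splitSum_congr hterm, H.smash_barD_word u hb, hleft,
    H.smash_word u (H.d_mem_gr hb), splitSum_sub, splitSum_add, splitSum_sub, splitSum_add, hcap,
    ← splitSum_smul]
  have hd : splitSum u (fun p q => ksign R (wdeg u) • ksign R (wdeg q * (j + 1) + wdeg p) •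
      (H.op (word p) (H.d b) ⊗ₜ[R] word q)) =
      splitSum u fun p q => ksign R (wdeg q * j) • (H.op (word p) (H.d b) ⊗ₜ word q) := by
    refine splitSum_congr fun p q hu => ?_
    rw [smul_smul, ← ksign_add, ← hu, wdeg_append]
    congr 1
    exact ksign_congr ⟨wdeg p + wdeg q, by ring⟩
  rw [hd]
  abel

theorem leibniz_one_tmul_tmul_one (u : List H.gr.Letter) {j : ℤ} {b : A} (hb : b ∈ H.gr.deg j) :
    H.acyclicD (H.amul (H.one ⊗ₜ word u) (b ⊗ₜ 1)) =
      H.amul (H.acyclicD (H.one ⊗ₜ word u)) (b ⊗ₜ 1) +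
        ksign R (wdeg u) • H.amul (H.one ⊗ₜ word u) (H.d b ⊗ₜ 1) := by
  have hcap : H.amul (H.cap (H.one ⊗ₜ word u)) (b ⊗ₜ 1) =
      splitSum u fun p q => H.lmul (H.gr.univ (word p)) (H.smash (word q ⊗ₜ b)) := by
    rw [DGA.cap_one_tmul_word, ← LinearMap.flip_apply, map_splitSum]
    refine splitSum_congr fun p q _ => ?_
    rw [LinearMap.flip_apply, ← lmul_one_tmul, amul_lmul, one_tmul_amul_tmul_one]
  rw [one_tmul_amul_tmul_one, one_tmul_amul_tmul_one, DGA.acyclicD_one_tmul, map_sub,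
    LinearMap.sub_apply, hcap, one_tmul_amul_tmul_one, H.acyclicD_smash_word u hb]

theorem leibniz (s t : A ⊗[R] H.Bar) : H.acyclicD (H.amul s t) =
    H.amul (H.acyclicD s) t + H.amul (H.tensorSgn s) (H.acyclicD t) := by
  induction t using tmul_word_induction H.gr with
  | zero => simp
  | add t t' ht ht' => simp only [map_add, ht, ht']; abel
  | smul r t ht => simp only [map_smul, ht, smul_add]
  | tmul j b hb v =>
    refine H.leibniz_of_one_tmul (fun u => ?_) s
    -- With this factorization and associativity, the rule for the pair `(1 ⊗ u, b ⊗ v)` follows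
    -- from those for `((1 ⊗ u)(b ⊗ 1), 1 ⊗ v)`, `(1 ⊗ u, b ⊗ 1)` and `(b ⊗ 1, 1 ⊗ v)`.
    have hbv : b ⊗ₜ[R] word v = H.amul (b ⊗ₜ 1) (H.one ⊗ₜ word v) := by
      rw [tmul_one_amul, lmul_one_tmul]
    have hmem : H.amul (H.one ⊗ₜ word u) (b ⊗ₜ 1) ∈ H.gr.tensorDeg H.gr.bar (wdeg u + j) := by
      have h := H.amul_mem (tmul_mem_tensorDeg _ _ H.one_mem_gr (word_mem u))
        (tmul_mem_tensorDeg _ _ hb (word_mem ([] : List H.gr.Letter)))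
      simpa using h
    have hd : H.acyclicD (b ⊗ₜ word v) = H.amul (H.d b ⊗ₜ 1) (H.one ⊗ₜ word v) +
        ksign R j • H.amul (b ⊗ₜ 1) (H.acyclicD (H.one ⊗ₜ word v)) := by
      rw [tmul_one_amul, tmul_one_amul, ← H.acyclicD_lmul hb, lmul_one_tmul]
    rw [hd, hbv, ← amul_assoc, H.leibniz_of_one_tmul (fun u => H.leibniz_one_tmul u v),
      H.leibniz_one_tmul_tmul_one u hb, H.tensorSgn_apply hmem]
    simp only [map_add, map_smul, LinearMap.add_apply, LinearMap.smul_apply, ← amul_assoc,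
      ksign_add]
    module

end HomotopyGAlgebra

theorem mainTheorem9 {R A : Type*} [CommRing R] [AddCommGroup A] [Module R A]
    (H : HomotopyGAlgebra R A) :
    IsDGA (H.gr.tensorDeg H.gr.bar) H.toDGA.acyclicD (H.toDGA.twistedMul H.E)
      (H.one ⊗ₜ[R] (1 : H.toDGA.Bar)) where
  internal := H.gr.tensorDeg_internal H.gr.bar
  one_mem := by
    simpa using GrMod.tmul_mem_tensorDeg _ _ H.one_mem_gr
      (GrMod.word_mem ([] : List H.gr.Letter))
  mul_mem _ _ _ hs _ ht := H.amul_mem hs ht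
  one_mul := H.one_amul
  mul_one := H.amul_one
  mul_assoc := H.amul_assoc
  d_mem _ _ ht := H.acyclicD_mem ht
  d_d := H.acyclicD_acyclicD
  leibniz i s hs t := by
    rw [H.leibniz, H.tensorSgn_apply hs, map_smul, LinearMap.smul_apply, negOnePow_smul (R := R)]
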